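/- Let $K$ be a field and let $m,n,p,q$ be positive integers with $n>1$ and $mp>1$. A base case $\langle m,n,p\rangle=q$ is a bilinear algorithm for multiplying an $m\times n$ matrix $A$ by an $n\times p$ matrix $B$ with $q$ scalar multiplications: a straight-line program of binary operations $(x,y)\mapsto \alpha x+\beta y$ ($\alpha,\beta\in K$ constants) computes $q$ linear combinations of the entries of $A$, a second one computes $q$ linear combinations of the entries of $B$, the $r$-th combinations are multiplied for $r=1,\dots,q$, and a third program computes the $mp$ entries of $C$ as linear combinations of the $q$ products. The result is $C=AB$ identically, or (approximate algorithms) up to terms of positive order for some discrete valuation of $K$, e.g. up to terms of order $\lambda$ if $K$ is a field of rational functions in $\lambda$. The decoding graph $Dec_1C$ is the computational graph of the third program: one vertex for each of the $q$ products and for each operation, and an edge between each operation and each of its operands. For $t\ge 0$ let $\langle m^t,n^t,p^t\rangle=q^t$ be the algorithm obtained from the base case by $t$ recursive (tensor-power) steps: for $t=0$ it is one scalar multiplication; for $t+1$ the base case is applied to blocks, its linear operations entry by entry, its $q$ multiplications being recursive calls of the $t$-step algorithm. Its computational graph has one vertex per input entry and per arithmetic operation. It is executed on a machine with a fast memory of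 $M$ words and an unbounded slow memory: inputs are initially in slow memory and fast memory is empty, an operation needs its operands and its result in fast memory, every operation is performed exactly once, in any order compatible with the graph, and at the end all outputs are in slow memory. The communication cost $W$ of an execution is the number of words moved between the two memories. **Theorem.** Suppose that $Dec_1C$ is connected (as an undirected graph). 1. There is a constant $c>0$, depending only on the base case, such that for all $t\ge0$ and $M\ge1$ every execution of the $t$-step algorithm with fast memory $M$ has $$W\ \ge\ c\,\frac{q^t}{M^{\log_{mp}q-1}} .$$ 2. If $n\le m$ and $n\le p$, this bound is tight: there is a constant $C>0$, depending only on the base case, such that for all $t\ge0$ and all $M$ with $3\le M\le 3(mp)^t$ there is an execution with fast memory $M$ and $$W\ \le\ C\,\frac{q^t}{M^{\log_{mp}q-1}} ,$$ and its operations can be taken in the order of the naive recursive algorithm (at every level: encode the blocks of $A$ and $B$, perform the $q$ recursive calls one after the other, decode the blocks of $C$). -/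

import Mathlib

open scoped WithZero

/-- A straight-line program of binary linear operations with inputs indexed by `ι` and outputs
indexed by `κ`: operation `g` forms `a g • (first operand) + b g • (second operand)`, where each
operand is an input or an earlier operation (a unary scaling has two equal operands).
An output is an operation or an input (a copied input). -/
structure LinCircuit (K ι κ : Type*) where
  size : ℕ
  a : Fin size → K
  b : Fin size → K
  fst : Fin size → ι ⊕ Fin size
  snd : Fin size → ι ⊕ Fin size
  fst_lt : ∀ g h, fst g = Sum.inr h → h < g
  snd_lt : ∀ g h, snd g = Sum.inr h → h < g
  out : κ → ι ⊕ Fin size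

namespace LinCircuit

variable {K ι κ : Type*}

/-- Position of a vertex in the straight-line order, inputs coming first. -/
def rank (c : LinCircuit K ι κ) : ι ⊕ Fin c.size → ℕ
  | Sum.inl _ => 0
  | Sum.inr g => g.val + 1

theorem rank_fst (c : LinCircuit K ι κ) (g : Fin c.size) : c.rank (c.fst g) < g.val + 1 := by
  rcases h : c.fst g with i | k
  · simp [rank]
  · have := c.fst_lt g k h
    simpa [rank] using this

theorem rank_snd (c : LinCircuit K ι κ) (g : Fin c.size) : c.rank (c.snd g) < g.val + 1 := by
  rcases h : c.snd g with i | k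
  · simp [rank]
  · have := c.snd_lt g k h
    simpa [rank] using this

/-- The linear form (vector of coefficients) in the inputs that is computed at a vertex. -/
def form [Field K] [DecidableEq ι] (c : LinCircuit K ι κ) : ι ⊕ Fin c.size → ι → K
  | Sum.inl i => fun j => if j = i then 1 else 0
  | Sum.inr g => fun j => c.a g * form c (c.fst g) j + c.b g * form c (c.snd g) j
termination_by v => c.rank v
decreasing_by
  · exact c.rank_fst g
  · exact c.rank_snd g

theorem form_inl [Field K] [DecidableEq ι] (c : LinCircuit K ι κ) (i j : ι) :
    c.form (Sum.inl i) j = if j = i then 1 else 0 := by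
  rw [form]

theorem form_inr [Field K] [DecidableEq ι] (c : LinCircuit K ι κ) (g : Fin c.size) (j : ι) :
    c.form (Sum.inr g) j = c.a g * c.form (c.fst g) j + c.b g * c.form (c.snd g) j := by
  rw [form]

/-- The computational graph of the program, with directions forgotten: a vertex for every input
and every operation, an edge between every operation and each of its operands. -/
def graph (c : LinCircuit K ι κ) : SimpleGraph (ι ⊕ Fin c.size) :=
  SimpleGraph.fromRel fun u v => ∃ g, v = Sum.inr g ∧ (u = c.fst g ∨ u = c.snd g)

end LinCircuit

/-- A bilinear algorithm with `q` scalar multiplications for an `m × n` times an `n × p` matrix: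
programs for the `q` linear combinations of entries of `A`, for the `q` linear combinations of
entries of `B`, and for the entries of `C` as linear combinations of the `q` products. -/
structure BaseCase (K : Type*) (m n p q : ℕ) where
  encA : LinCircuit K (Fin m × Fin n) (Fin q)
  encB : LinCircuit K (Fin n × Fin p) (Fin q)
  decC : LinCircuit K (Fin q) (Fin m × Fin p)

namespace BaseCase

variable {K : Type*} {m n p q : ℕ}

/-- The coefficient of `A i j * B j' k` in the computed value of `C i' k'`, minus its coefficient
in the entry `C i' k'` of the matrix product. -/
def error [Field K] (B : BaseCase K m n p q)
    (i : Fin m) (j j' : Fin n) (k : Fin p) (i' : Fin m) (k' : Fin p) : K :=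
  (∑ r : Fin q, B.encA.form (B.encA.out r) (i, j) * B.encB.form (B.encB.out r) (j', k) *
      B.decC.form (B.decC.out (i', k')) r) -
    if i = i' ∧ j = j' ∧ k = k' then 1 else 0

/-- The algorithm multiplies matrices exactly. -/
def IsExact [Field K] (B : BaseCase K m n p q) : Prop :=
  ∀ i j j' k i' k', B.error i j j' k i' k' = 0

/-- The algorithm multiplies matrices approximately, with an error of positive order. For the
`T`-adic valuation on a field of rational functions or Laurent series in `T`, this is
correctness up to terms of order `T`. -/
def IsApproximate [Field K] (B : BaseCase K m n p q) (v : Valuation K ℤᵐ⁰) : Prop :=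
  ∀ i j j' k i' k', v (B.error i j j' k i' k') < 1

/-- The inputs of the `t`-fold recursive algorithm: the entries of an `m^t × n^t` matrix and of an
`n^t × p^t` matrix. A row (column) index is a word of `t` digits, the first digit selecting the
block of the outermost recursive level; an entry is given by the word of its pairs of digits. -/
abbrev Inp (_B : BaseCase K m n p q) (t : ℕ) : Type :=
  (Fin t → Fin m × Fin n) ⊕ (Fin t → Fin n × Fin p)

/-- The arithmetic operations of the `t`-fold recursive algorithm. For `t = 0` this is one scalar
multiplication. For `t + 1` the base case acts on blocks: its linear operations on blocks of `A`,
on blocks of `B` and on the block products are done entry by entry, and its `q` multiplications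
are calls of the `t`-fold recursive algorithm (`sub r o` is operation `o` of the `r`th call). -/
inductive Op (B : BaseCase K m n p q) : ℕ → Type
  | prod : Op B 0
  | encA {t : ℕ} (g : Fin B.encA.size) (x : Fin t → Fin m × Fin n) : Op B (t + 1)
  | encB {t : ℕ} (g : Fin B.encB.size) (y : Fin t → Fin n × Fin p) : Op B (t + 1)
  | sub {t : ℕ} (r : Fin q) (o : Op B t) : Op B (t + 1)
  | decC {t : ℕ} (g : Fin B.decC.size) (z : Fin t → Fin m × Fin p) : Op B (t + 1)

/-- The vertices of the computational graph: one per input and one per operation. -/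
abbrev Vertex (B : BaseCase K m n p q) (t : ℕ) : Type := B.Inp t ⊕ B.Op t

/-- The vertex holding entry `x` of the block at a vertex of the base-case encoding of `A`. -/
def vertexA (B : BaseCase K m n p q) {t : ℕ} (x : Fin t → Fin m × Fin n) :
    (Fin m × Fin n) ⊕ Fin B.encA.size → B.Vertex (t + 1)
  | Sum.inl i => Sum.inl (Sum.inl (Fin.cons i x))
  | Sum.inr g => Sum.inr (Op.encA g x)

/-- The vertex holding entry `y` of the block at a vertex of the base-case encoding of `B`. -/
def vertexB (B : BaseCase K m n p q) {t : ℕ} (y : Fin t → Fin n × Fin p) :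
    (Fin n × Fin p) ⊕ Fin B.encB.size → B.Vertex (t + 1)
  | Sum.inl i => Sum.inl (Sum.inr (Fin.cons i y))
  | Sum.inr g => Sum.inr (Op.encB g y)

/-- The vertices of the `r`th recursive call inside the computational graph of the caller. The
inputs of the call are the entries of the `r`th encoded blocks. -/
def embed (B : BaseCase K m n p q) {t : ℕ} (r : Fin q) : B.Vertex t → B.Vertex (t + 1)
  | Sum.inl (Sum.inl x) => B.vertexA x (B.encA.out r)
  | Sum.inl (Sum.inr y) => B.vertexB y (B.encB.out r)
  | Sum.inr o => Sum.inr (Op.sub r o)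

/-- The vertex holding an entry of the resulting `m^t × p^t` matrix. -/
def outC (B : BaseCase K m n p q) : (t : ℕ) → (Fin t → Fin m × Fin p) → B.Vertex t
  | 0, _ => Sum.inr Op.prod
  | t + 1, z =>
    match B.decC.out (z 0) with
    | Sum.inl r => B.embed r (outC B t (Fin.tail z))
    | Sum.inr g => Sum.inr (Op.decC g (Fin.tail z))

/-- The vertex holding entry `z` of the block at a vertex of the base-case decoding of `C`; the
inputs of the decoding are the results of the `q` recursive calls. -/
def vertexC (B : BaseCase K m n p q) {t : ℕ} (z : Fin t → Fin m × Fin p) :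
    Fin q ⊕ Fin B.decC.size → B.Vertex (t + 1)
  | Sum.inl r => B.embed r (B.outC t z)
  | Sum.inr g => Sum.inr (Op.decC g z)

/-- First operand of an operation. -/
def opFst (B : BaseCase K m n p q) : {t : ℕ} → B.Op t → B.Vertex t
  | _, Op.prod => Sum.inl (Sum.inl Fin.elim0)
  | _, Op.encA g x => B.vertexA x (B.encA.fst g)
  | _, Op.encB g y => B.vertexB y (B.encB.fst g)
  | _, Op.sub r o => B.embed r (opFst B o)
  | _, Op.decC g z => B.vertexC z (B.decC.fst g)

/-- Second operand of an operation. -/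
def opSnd (B : BaseCase K m n p q) : {t : ℕ} → B.Op t → B.Vertex t
  | _, Op.prod => Sum.inl (Sum.inr Fin.elim0)
  | _, Op.encA g x => B.vertexA x (B.encA.snd g)
  | _, Op.encB g y => B.vertexB y (B.encB.snd g)
  | _, Op.sub r o => B.embed r (opSnd B o)
  | _, Op.decC g z => B.vertexC z (B.decC.snd g)

/-- The order of operations of the naive recursive algorithm: encode the blocks of `A` and `B`,
execute the `q` recursive calls one after the other, decode the blocks of `C`. -/
def IsNaiveOrder (B : BaseCase K m n p q) : (t : ℕ) → List (B.Op t) → Prop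
  | 0, _ => True
  | t + 1, L => ∃ (E D : List (B.Op (t + 1))) (S : Fin q → List (B.Op t)),
      L = E ++ (List.ofFn fun r => (S r).map (Op.sub r)).flatten ++ D ∧
      (∀ o ∈ E, (∃ g x, o = Op.encA g x) ∨ ∃ g y, o = Op.encB g y) ∧
      (∀ o ∈ D, ∃ g z, o = Op.decC g z) ∧
      ∀ r, IsNaiveOrder B t (S r)

end BaseCase

/-- A computational graph, given by its inputs, its binary operations with their operands, and the values
that it has to deliver. -/
structure Cdag where
  Inp : Type
  Op : Type
  fst : Op → Inp ⊕ Op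
  snd : Op → Inp ⊕ Op
  outputs : Set (Inp ⊕ Op)

/-- The computation of the `t`-fold recursive algorithm for `m^t × n^t` by `n^t × p^t` matrices. -/
abbrev BaseCase.power {K : Type*} {m n p q : ℕ} (B : BaseCase K m n p q) (t : ℕ) : Cdag where
  Inp := B.Inp t
  Op := B.Op t
  fst := B.opFst
  snd := B.opSnd
  outputs := Set.range (B.outC t)

namespace Cdag

/-- The values that occur: inputs and results of operations. -/
abbrev Val (G : Cdag) : Type := G.Inp ⊕ G.Op

/-- The instructions of a machine with a fast and a slow memory. -/
inductive Instr (G : Cdag)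
  | read (v : G.Val)
  | write (v : G.Val)
  | discard (v : G.Val)
  | compute (o : G.Op)

/-- The contents of the two memories. -/
structure State (G : Cdag) where
  fast : Set G.Val
  slow : Set G.Val

/-- One instruction on a machine whose fast memory holds `M` words and whose slow memory is
unbounded; operands and results of operations are in fast memory. -/
inductive Step (G : Cdag) (M : ℕ) : G.State → G.Instr → G.State → Prop
  | read (F S : Set G.Val) (v : G.Val) (hv : v ∈ S) (hM : (insert v F).encard ≤ M) :
      Step G M ⟨F, S⟩ (Instr.read v) ⟨insert v F, S⟩
  | write (F S : Set G.Val) (v : G.Val) (hv : v ∈ F) :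
      Step G M ⟨F, S⟩ (Instr.write v) ⟨F, insert v S⟩
  | discard (F S : Set G.Val) (v : G.Val) :
      Step G M ⟨F, S⟩ (Instr.discard v) ⟨F \ {v}, S⟩
  | compute (F S : Set G.Val) (o : G.Op) (h₁ : G.fst o ∈ F) (h₂ : G.snd o ∈ F)
      (hM : (insert (Sum.inr o) F).encard ≤ M) :
      Step G M ⟨F, S⟩ (Instr.compute o) ⟨insert (Sum.inr o) F, S⟩

/-- Execution of a list of instructions. -/
inductive Run (G : Cdag) (M : ℕ) : G.State → List G.Instr → G.State → Prop
  | nil (σ : G.State) : Run G M σ [] σ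
  | cons (σ τ ρ : G.State) (i : G.Instr) (s : List G.Instr)
      (h : Step G M σ i τ) (hs : Run G M τ s ρ) : Run G M σ (i :: s) ρ

/-- The operations in the order in which they are performed. -/
def order (G : Cdag) (s : List G.Instr) : List G.Op :=
  s.filterMap fun i => match i with
    | Instr.compute o => some o
    | _ => none

/-- The number of words transferred between fast and slow memory. -/
def words (G : Cdag) (s : List G.Instr) : ℕ :=
  s.countP fun i => match i with
    | Instr.read _ => true
    | Instr.write _ => true
    | _ => false

/-- `s` carries out the computation with a fast memory of `M` words: it starts with the inputs in
slow memory and an empty fast memory, performs every operation exactly once, and ends with all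
outputs in slow memory. -/
def IsSchedule (G : Cdag) (M : ℕ) (s : List G.Instr) : Prop :=
  (∃ τ : G.State, Run G M ⟨∅, Set.range Sum.inl⟩ s τ ∧ G.outputs ⊆ τ.slow) ∧
    (G.order s).Nodup ∧ ∀ o, o ∈ G.order s

end Cdag

/-! ### Consequences of correctness: distinct outputs and `m * p < q` -/

namespace BaseCase

variable {K : Type*} {m n p q : ℕ}

/-! The lower bound routes paths through the decoding graphs and counts how many a schedule segment
must cut. Inside a call of power `k`, every product is joined to every output by a route containing
one full copy of the decoding graph per level; connectedness makes the route connected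
(`route_linked`), and `m * p < q` makes the count of routes through one operation a geometric sum
dominated by `m * p * q ^ (k + 1)` (`ncard_route_le`).

If a set of operations contains at most half of the `q ^ k` products of a call, then each of its
products is separated by the set from an output, or compensated by another product that is, so that
at least (number of its products) times `(m * p) ^ k` pairs are separated
(`card_mul_le_card_not_iff`). Each such route meets the boundary, which is therefore large
(`card_mul_le_boundary`). Conversely, the boundary of the operations of a segment has at most `2 *
M` elements plus the words moved in it (`encard_boundary_le`). With `q ^ j` products per segment and
`(m * p) ^ j` a large enough constant multiple of `M`, every segment moves at least `M` words;
adding over the segments gives `mul_pow_le_words`. When `t` is too small for this, writing the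
outputs already costs enough (`pow_le_words`).

For the upper bound, the naive recursion is run entirely in fast memory on calls of the largest
power that fits, and with three words per linear operation on the levels above. As `n ≤ m` and `n ≤
p`, all blocks are at most as large as those of `C`, so `m * p < q` lets the innermost of these
levels dominate the cost (`Placement.exec_internal`, `Placement.exec_external`, `cost_le`).

The algebra enters only through `m * p < q` and the injectivity of the output map, both proved for
approximate algorithms with a valuation. -/

theorem exists_isApproximate [Field K] (B : BaseCase K m n p q)
    (hB : B.IsExact ∨ ∃ v : Valuation K ℤᵐ⁰, B.IsApproximate v) :
    ∃ v : Valuation K ℤᵐ⁰, B.IsApproximate v := by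
  classical
  rcases hB with h | h
  -- Exactness is approximation for the trivial valuation.
  · exact ⟨1, fun i j j' k i' k' => by rw [h]; simp⟩
  · exact h

/-- Entries read off the same vertex have equal computed coefficients, although one coefficient
should be near 1 and the other near 0; the difference of the two errors is 1, which does not have
positive order. -/
theorem decC_out_injective [Field K] (B : BaseCase K m n p q) (v : Valuation K ℤᵐ⁰)
    (hv : B.IsApproximate v) (hn : 0 < n) : Function.Injective B.decC.out := by
  rintro ⟨i, k⟩ ⟨i', k'⟩ h
  by_contra hne
  have h1 := hv i ⟨0, hn⟩ ⟨0, hn⟩ k i k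
  have h2 := hv i ⟨0, hn⟩ ⟨0, hn⟩ k i' k'
  have h3 : B.error i ⟨0, hn⟩ ⟨0, hn⟩ k i' k' - B.error i ⟨0, hn⟩ ⟨0, hn⟩ k i k = 1 := by
    have hc : ¬ (i = i' ∧ k = k') := fun hh => hne (by rw [hh.1, hh.2])
    simp only [error, h, true_and, and_self, if_true, hc, if_false]
    ring
  have h4 := (v.map_sub _ _).trans_lt (max_lt h2 h1)
  rw [h3, map_one] at h4
  exact lt_irrefl _ h4

/-- The decoding functionals admit a nonzero combination that sees at most one product. -/
theorem exists_functional [Field K] (γ : Fin q → Fin m × Fin p → K) (hq : q ≤ m * p)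
    (hmp : 0 < m * p) :
    ∃ X : Fin m × Fin p → K, X ≠ 0 ∧ ∀ r : Fin q, r.val ≠ 0 → ∑ z, X z * γ r z = 0 := by
  let Φ : (Fin m × Fin p → K) →ₗ[K] ({r : Fin q // r.val ≠ 0} → K) :=
    { toFun := fun X r => ∑ z, X z * γ r z
      map_add' := fun X Y => by
        ext r; simp [add_mul, Finset.sum_add_distrib]
      map_smul' := fun a X => by
        ext r; simp [mul_assoc, Finset.mul_sum] }
  -- Product 0 imposes no condition, so fewer than `m * p` linear conditions act on `m * p`
  -- unknowns.
  have hcard : Fintype.card {r : Fin q // r.val ≠ 0} < m * p := by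
    rcases Nat.eq_zero_or_pos q with rfl | h0
    · simpa using hmp
    · refine lt_of_lt_of_le ?_ hq
      conv_rhs => rw [← Fintype.card_fin q]
      exact Fintype.card_subtype_lt (x := (⟨0, h0⟩ : Fin q)) (by simp)
  have hk : LinearMap.ker Φ ≠ ⊥ := by
    apply LinearMap.ker_ne_bot_of_finrank_lt
    simpa using hcard
  obtain ⟨X, hX, hX0⟩ := (Submodule.ne_bot_iff _).1 hk
  exact ⟨X, hX0, fun r hr => congrFun (LinearMap.mem_ker.1 hX) ⟨r, hr⟩⟩

/-- A base case needs more products than the result has entries. -/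
theorem mul_lt_of_isApproximate [Field K] (B : BaseCase K m n p q) (v : Valuation K ℤᵐ⁰)
    (hv : B.IsApproximate v) (hn : 1 < n) (hmp : 0 < m * p) : m * p < q := by
  by_contra hq
  push Not at hq
  obtain ⟨X, hX0, hX⟩ := exists_functional
    (fun r z => B.decC.form (B.decC.out z) r) hq hmp
  have : Nonempty (Fin m × Fin p) := by
    rw [← Fintype.card_pos_iff]; simpa using hmp
  -- Maximality makes the errors of all entries, weighted by `X`, small compared with `X (i, k)`.
  -- Hence `f` below approximates `X (i, k)` times the identity matrix.
  obtain ⟨⟨i, k⟩, hmax⟩ := Finite.exists_max fun z => v (X z)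
  have hpos : 0 < v (X (i, k)) := by
    obtain ⟨z, hz⟩ := Function.ne_iff.1 hX0
    exact lt_of_lt_of_le ((Valuation.pos_iff v).2 hz) (hmax z)
  let f : Fin n → Fin n → K := fun j j' => ∑ z : Fin m × Fin p, X z *
    ∑ r : Fin q, B.encA.form (B.encA.out r) (i, j) * B.encB.form (B.encB.out r) (j', k) *
      B.decC.form (B.decC.out z) r
  have hf : ∀ j j', f j j' = ∑ r : Fin q, B.encA.form (B.encA.out r) (i, j) *
      B.encB.form (B.encB.out r) (j', k) * ∑ z, X z * B.decC.form (B.decC.out z) r := by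
    intro j j'
    simp only [f, Finset.mul_sum]
    rw [Finset.sum_comm]
    refine Finset.sum_congr rfl fun r _ => Finset.sum_congr rfl fun z _ => by ring
  let j₁ : Fin n := ⟨0, by omega⟩
  let j₂ : Fin n := ⟨1, hn⟩
  -- Only product 0 survives under `X`, so `f` has rank at most one, whereas an approximate multiple
  -- of the identity has a nonvanishing 2 × 2 minor.
  have hdet : f j₁ j₁ * f j₂ j₂ = f j₁ j₂ * f j₂ j₁ := by
    rcases Nat.eq_zero_or_pos q with rfl | h0
    · simp [f]
    · have hf' : ∀ j j', f j j' = B.encA.form (B.encA.out ⟨0, h0⟩) (i, j) *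
          B.encB.form (B.encB.out ⟨0, h0⟩) (j', k) *
            ∑ z, X z * B.decC.form (B.decC.out z) ⟨0, h0⟩ := by
        intro j j'
        rw [hf]
        refine Finset.sum_eq_single _ (fun r _ hr => ?_) (by simp)
        rw [hX r (fun h => hr (Fin.ext h)), mul_zero]
      simp only [hf']
      ring
  have herr : ∀ j j', v (f j j' - if j = j' then X (i, k) else 0) < v (X (i, k)) := by
    intro j j'
    have : f j j' - (if j = j' then X (i, k) else 0) =
        ∑ z : Fin m × Fin p, X z * B.error i j j' k z.1 z.2 := by
      simp only [f, error, mul_sub, Finset.sum_sub_distrib]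
      congr 1
      rw [Finset.sum_eq_single (i, k)]
      · simp
      · rintro ⟨a, b⟩ _ hne
        have : ¬ (i = a ∧ j = j' ∧ k = b) := fun h => hne (by rw [h.1, h.2.2])
        simp [this]
      · simp
    rw [this]
    refine v.map_sum_lt hpos.ne' fun z _ => ?_
    rw [map_mul]
    calc v (X z) * v (B.error i j j' k z.1 z.2) ≤ v (X (i, k)) * v (B.error i j j' k z.1 z.2) :=
          mul_le_mul_left (hmax z) _
      _ < v (X (i, k)) * 1 := by
          exact mul_lt_mul_of_pos_left (hv _ _ _ _ _ _) hpos
      _ = _ := mul_one _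
  have hdiag : ∀ j, v (f j j) = v (X (i, k)) := by
    intro j
    have := herr j j
    rw [if_pos rfl] at this
    exact Valuation.map_eq_of_sub_lt v this
  have hne : j₁ ≠ j₂ := by simp [j₁, j₂]
  have h12 : v (f j₁ j₂) < v (X (i, k)) := by simpa [hne] using herr j₁ j₂
  have h21 : v (f j₂ j₁) < v (X (i, k)) := by simpa [hne.symm] using herr j₂ j₁
  have h := congrArg v hdet
  rw [map_mul, map_mul, hdiag, hdiag] at h
  exact absurd h (mul_lt_mul'' h12 h21 zero_le zero_le).ne'

end BaseCase

/-! ### Boundaries and routes through the decoding graphs -/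

namespace Cdag

/-- `u` is an operand of `v`. -/
def Operand (G : Cdag) (u v : G.Op) : Prop := G.fst v = Sum.inr u ∨ G.snd v = Sum.inr u

/-- `u` and `v` are operations in `P`, one of which is an operand of the other. -/
def Link (G : Cdag) (P : Set G.Op) (u v : G.Op) : Prop :=
  u ∈ P ∧ v ∈ P ∧ (G.Operand u v ∨ G.Operand v u)

/-- Operations that are operands across the boundary of `S`. -/
def boundary (G : Cdag) (S : Set G.Op) : Set G.Op :=
  {u | ∃ v, G.Operand u v ∧ ¬(u ∈ S ↔ v ∈ S)}

/-- Membership in `S` changes at some link of the chain; the operand end of that link is in the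
boundary, and both ends are in `P`. -/
theorem exists_mem_boundary {G : Cdag} {P S : Set G.Op} {a b : G.Op}
    (h : Relation.ReflTransGen (G.Link P) a b) (hab : ¬(a ∈ S ↔ b ∈ S)) :
    ∃ u ∈ P, u ∈ G.boundary S := by
  induction h with
  | refl => exact absurd Iff.rfl hab
  | @tail c d _ hcd ih =>
    by_cases hc : a ∈ S ↔ c ∈ S
    · obtain ⟨h1, h2, h3 | h3⟩ := hcd
      · exact ⟨c, h1, d, h3, fun h => hab (hc.trans h)⟩
      · exact ⟨d, h2, c, h3, fun h => hab (hc.trans h.symm)⟩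
    · exact ih hc

end Cdag

namespace BaseCase

variable {K : Type*} {m n p q : ℕ} (B : BaseCase K m n p q)

/-- The operation that delivers an entry of the result. -/
def outOp : (t : ℕ) → (Fin t → Fin m × Fin p) → B.Op t
  | 0, _ => Op.prod
  | t + 1, z =>
    match B.decC.out (z 0) with
    | Sum.inl r => Op.sub r (outOp t (Fin.tail z))
    | Sum.inr g => Op.decC g (Fin.tail z)

/-- The operation at a vertex of the decoding of the block entry `z`. -/
def decOp {t : ℕ} (z : Fin t → Fin m × Fin p) : Fin q ⊕ Fin B.decC.size → B.Op (t + 1)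
  | Sum.inl r => Op.sub r (B.outOp t z)
  | Sum.inr g => Op.decC g z

theorem outOp_succ {t : ℕ} (z : Fin (t + 1) → Fin m × Fin p) :
    B.outOp (t + 1) z = B.decOp (Fin.tail z) (B.decC.out (z 0)) := by
  rw [outOp]
  rcases B.decC.out (z 0) with r | g <;> rfl

theorem outC_eq : ∀ (t : ℕ) (z : Fin t → Fin m × Fin p), B.outC t z = Sum.inr (B.outOp t z)
  | 0, _ => rfl
  | t + 1, z => by
    rw [outC, outOp]
    rcases B.decC.out (z 0) with r | g
    · simp only [outC_eq t, embed]
    · rfl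

theorem vertexC_eq {t : ℕ} (z : Fin t → Fin m × Fin p) (v : Fin q ⊕ Fin B.decC.size) :
    B.vertexC z v = Sum.inr (B.decOp z v) := by
  rcases v with r | g
  · simp only [vertexC, decOp, outC_eq, embed]
  · rfl

theorem decOp_inj {t : ℕ} (ht : Function.Injective (B.outOp t)) {z z' : Fin t → Fin m × Fin p}
    {v v' : Fin q ⊕ Fin B.decC.size} (h : B.decOp z v = B.decOp z' v') : z = z' ∧ v = v' := by
  rcases v with r | g <;> rcases v' with r' | g' <;> simp only [decOp] at h
  · injection h with _ h1 h2
    exact ⟨ht h2, by rw [h1]⟩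
  · cases h
  · cases h
  · injection h with _ h1 h2
    exact ⟨h2, by rw [h1]⟩

theorem outOp_injective (hinj : Function.Injective B.decC.out) :
    ∀ t, Function.Injective (B.outOp t)
  | 0 => fun _ _ _ => Subsingleton.elim _ _
  | t + 1 => by
    intro z z' h
    rw [outOp_succ, outOp_succ] at h
    obtain ⟨h1, h2⟩ := B.decOp_inj (outOp_injective hinj t) h
    rw [← Fin.cons_self_tail z, ← Fin.cons_self_tail z', h1, hinj h2]

/-- The scalar multiplication reached by a sequence of recursive calls. -/
def prodOp : (t : ℕ) → (Fin t → Fin q) → B.Op t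
  | 0, _ => Op.prod
  | t + 1, x => Op.sub (x 0) (prodOp t (Fin.tail x))

theorem prodOp_injective : ∀ t, Function.Injective (B.prodOp t)
  | 0 => fun _ _ _ => Subsingleton.elim _ _
  | t + 1 => by
    intro x x' h
    simp only [prodOp] at h
    injection h with _ h1 h2
    rw [← Fin.cons_self_tail x, ← Fin.cons_self_tail x', h1, prodOp_injective t h2]

/-- Operations of the algorithm for power `k` inside a nested recursive call. -/
def subs {k : ℕ} : (d : ℕ) → (Fin d → Fin q) → B.Op k → B.Op (k + d)
  | 0, _, o => o
  | d + 1, w, o => Op.sub (w 0) (subs d (Fin.tail w) o)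

theorem subs_inj {k : ℕ} : ∀ (d : ℕ) {w w' : Fin d → Fin q} {o o' : B.Op k},
    B.subs d w o = B.subs d w' o' → w = w' ∧ o = o'
  | 0, _, _, _, _, h => ⟨Subsingleton.elim _ _, h⟩
  | d + 1, w, w', o, o', h => by
    simp only [subs] at h
    injection h with _ h1 h2
    obtain ⟨h3, h4⟩ := subs_inj d h2
    rw [← Fin.cons_self_tail w, ← Fin.cons_self_tail w', h1, h3]
    exact ⟨rfl, h4⟩

theorem operand_sub {t : ℕ} {u v : B.Op t} (r : Fin q) (h : (B.power t).Operand u v) :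
    (B.power (t + 1)).Operand (Op.sub r u) (Op.sub r v) := by
  rcases h with h | h
  · left
    change B.embed r (B.opFst v) = _
    rw [show B.opFst v = _ from h]
    rfl
  · right
    change B.embed r (B.opSnd v) = _
    rw [show B.opSnd v = _ from h]
    rfl

theorem operand_subs {k : ℕ} {u v : B.Op k} (h : (B.power k).Operand u v) :
    ∀ (d : ℕ) (w : Fin d → Fin q), (B.power (k + d)).Operand (B.subs d w u) (B.subs d w v)
  | 0, _ => h
  | d + 1, w => B.operand_sub (w 0) (operand_subs h d (Fin.tail w))

/-- Vertices of a route from a product to an entry of the result: at every level, all the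
vertices of one copy of the decoding graph. -/
def route : (t : ℕ) → (Fin t → Fin q) → (Fin t → Fin m × Fin p) → Set (B.Op t)
  | 0, _, _ => Set.univ
  | t + 1, x, z => Op.sub (x 0) '' route t (Fin.tail x) (Fin.tail z) ∪
      Set.range (B.decOp (Fin.tail z))

theorem link_decOp {t : ℕ} (z : Fin t → Fin m × Fin p) {u v : Fin q ⊕ Fin B.decC.size}
    (h : B.decC.graph.Adj u v) :
    (B.power (t + 1)).Link (Set.range (B.decOp z)) (B.decOp z u) (B.decOp z v) := by
  have key : ∀ {u v : Fin q ⊕ Fin B.decC.size},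
      (∃ g, v = Sum.inr g ∧ (u = B.decC.fst g ∨ u = B.decC.snd g)) →
      (B.power (t + 1)).Operand (B.decOp z u) (B.decOp z v) := by
    rintro u _ ⟨g, rfl, rfl | rfl⟩
    · left
      exact B.vertexC_eq z _
    · right
      exact B.vertexC_eq z _
  rw [LinCircuit.graph, SimpleGraph.fromRel_adj] at h
  exact ⟨⟨u, rfl⟩, ⟨v, rfl⟩, h.2.imp key key⟩

theorem reflTransGen_decOp (hdec : B.decC.graph.Connected) {t : ℕ} (z : Fin t → Fin m × Fin p)
    (u v : Fin q ⊕ Fin B.decC.size) :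
    Relation.ReflTransGen ((B.power (t + 1)).Link (Set.range (B.decOp z)))
      (B.decOp z u) (B.decOp z v) := by
  have h := (SimpleGraph.reachable_iff_reflTransGen u v).1 (hdec.preconnected u v)
  exact h.lift _ fun a b hab => B.link_decOp z hab

/-- The output of the call chosen at a level is an input vertex of the decoding copy at that level,
so the chains concatenate. Taking whole copies avoids choosing paths and costs only a constant
factor in the count of routes. -/
theorem route_linked (hdec : B.decC.graph.Connected) : ∀ (t : ℕ) (x : Fin t → Fin q)
    (z : Fin t → Fin m × Fin p),
    Relation.ReflTransGen ((B.power t).Link (B.route t x z)) (B.prodOp t x) (B.outOp t z)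
  | 0, _, _ => Relation.ReflTransGen.refl
  | t + 1, x, z => by
    have h1 := route_linked hdec t (Fin.tail x) (Fin.tail z)
    have h2 := B.reflTransGen_decOp hdec (Fin.tail z) (Sum.inl (x 0)) (B.decC.out (z 0))
    rw [← outOp_succ] at h2
    refine Relation.ReflTransGen.trans (b := B.decOp (Fin.tail z) (Sum.inl (x 0))) ?_ ?_
    · refine h1.lift (Op.sub (x 0)) fun a b hab => ?_
      obtain ⟨ha, hb, hab⟩ := hab
      exact ⟨Or.inl ⟨a, ha, rfl⟩, Or.inl ⟨b, hb, rfl⟩,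
        hab.imp (B.operand_sub _) (B.operand_sub _)⟩
    · exact h2.lift id fun a b ⟨ha, hb, hab⟩ => ⟨Or.inr ha, Or.inr hb, hab⟩

/-- Routes through `o` either pass through it inside a recursive call or use it at the outermost
decoding; an output of a call can occur in both ways. The two counts give the recursion `N (t + 1) ≤
m * p * N t + m * p * q ^ (t + 1)`, which `m * p + 1 ≤ q` closes. -/
theorem ncard_route_le (hinj : Function.Injective B.decC.out) (h0 : 0 < m * p) (hq : m * p < q) :
    ∀ (t : ℕ) (o : B.Op t),
      {a : (Fin t → Fin q) × (Fin t → Fin m × Fin p) | o ∈ B.route t a.1 a.2}.ncard ≤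
        m * p * q ^ (t + 1)
  | 0, o => by
    refine (Set.ncard_le_one (Set.toFinite _)).2 (fun a _ b _ => Subsingleton.elim _ _) |>.trans ?_
    exact Nat.mul_pos h0 (pow_pos (by omega) _)
  | t + 1, o => by
    have hcov : {a : (Fin (t + 1) → Fin q) × (Fin (t + 1) → Fin m × Fin p) |
        o ∈ B.route (t + 1) a.1 a.2} ⊆
        {a | ∃ o', o = Op.sub (a.1 0) o' ∧ o' ∈ B.route t (Fin.tail a.1) (Fin.tail a.2)} ∪
        {a | ∃ v, o = B.decOp (Fin.tail a.2) v} := by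
      rintro ⟨x, z⟩ (⟨o', h, rfl⟩ | ⟨v, rfl⟩)
      · exact Or.inl ⟨o', rfl, h⟩
      · exact Or.inr ⟨v, rfl⟩
    -- The call containing `o` forces the first letter of `x`; only the first letter of `z` is free.
    have h1 : {a : (Fin (t + 1) → Fin q) × (Fin (t + 1) → Fin m × Fin p) |
        ∃ o', o = Op.sub (a.1 0) o' ∧ o' ∈ B.route t (Fin.tail a.1) (Fin.tail a.2)}.ncard ≤
        m * p * (m * p * q ^ (t + 1)) := by
      by_cases ho : ∃ r o', o = Op.sub r o'
      · obtain ⟨r, o', rfl⟩ := ho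
        refine le_trans (Set.ncard_le_ncard (t :=
          (fun b : (Fin m × Fin p) × ((Fin t → Fin q) × (Fin t → Fin m × Fin p)) =>
            ((Fin.cons r b.2.1 : Fin (t + 1) → Fin q),
              (Fin.cons b.1 b.2.2 : Fin (t + 1) → Fin m × Fin p))) ''
          (Set.univ ×ˢ {a | o' ∈ B.route t a.1 a.2})) ?_ (Set.toFinite _)) ?_
        · rintro ⟨x, z⟩ ⟨o'', h, hm⟩
          injection h with _ h1 h2
          subst h2
          refine ⟨(z 0, (Fin.tail x, Fin.tail z)), ⟨trivial, hm⟩, ?_⟩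
          simp only [h1, Fin.cons_self_tail]
        · refine (Set.ncard_image_le (Set.toFinite _)).trans ?_
          rw [Set.ncard_prod, Set.ncard_univ, Nat.card_prod, Nat.card_fin, Nat.card_fin]
          exact Nat.mul_le_mul le_rfl (ncard_route_le hinj h0 hq t o')
      · convert Nat.zero_le _
        refine (congrArg Set.ncard ?_).trans (Set.ncard_empty _)
        refine Set.eq_empty_of_forall_notMem ?_
        rintro a ⟨o', h, _⟩
        exact ho ⟨_, _, h⟩
    -- The decoding copy forces the tail of `z`; the product and the first letter of `z` are free.
    have h2 : {a : (Fin (t + 1) → Fin q) × (Fin (t + 1) → Fin m × Fin p) |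
        ∃ v, o = B.decOp (Fin.tail a.2) v}.ncard ≤ q ^ (t + 1) * (m * p) := by
      by_cases ho : ∃ z v, o = B.decOp z v
      · obtain ⟨z, v, rfl⟩ := ho
        refine le_trans (Set.ncard_le_ncard (t :=
          (fun b : (Fin (t + 1) → Fin q) × (Fin m × Fin p) =>
            (b.1, (Fin.cons b.2 z : Fin (t + 1) → Fin m × Fin p))) '' Set.univ)
          ?_ (Set.toFinite _)) ?_
        · rintro ⟨x, z'⟩ ⟨v', h⟩
          obtain ⟨h1, -⟩ := B.decOp_inj (B.outOp_injective hinj t) h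
          refine ⟨(x, z' 0), trivial, ?_⟩
          simp only [h1, Fin.cons_self_tail]
        · refine (Set.ncard_image_le (Set.toFinite _)).trans ?_
          rw [Set.ncard_univ]
          simp
      · convert Nat.zero_le _
        refine (congrArg Set.ncard ?_).trans (Set.ncard_empty _)
        refine Set.eq_empty_of_forall_notMem ?_
        rintro a ⟨v, h⟩
        exact ho ⟨_, v, h⟩
    refine (Set.ncard_le_ncard hcov (Set.toFinite _)).trans ((Set.ncard_union_le _ _).trans ?_)
    calc _ ≤ m * p * (m * p * q ^ (t + 1)) + q ^ (t + 1) * (m * p) := Nat.add_le_add h1 h2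
      _ = m * p * q ^ (t + 1) * (m * p + 1) := by ring
      _ ≤ m * p * q ^ (t + 1) * q := Nat.mul_le_mul le_rfl hq
      _ = _ := by ring

end BaseCase

/-! ### Counting separated pairs of a product and an output -/

/-- The separated pairs number `|P| * |¬Q| + |¬P| * |Q|`, and `|¬P| ≥ |P|`. Nothing is assumed about
`Q`, so the segment may contain any set of outputs. -/
theorem card_mul_le_card_not_iff {α β : Type*} [Fintype α] [Fintype β] (P : α → Prop)
    (Q : β → Prop) [DecidablePred P] [DecidablePred Q]
    (h : 2 * (Finset.univ.filter P).card ≤ Fintype.card α) :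
    (Finset.univ.filter P).card * Fintype.card β ≤
      (Finset.univ.filter fun a : α × β => ¬(P a.1 ↔ Q a.2)).card := by
  classical
  have hsub : (Finset.univ.filter P ×ˢ Finset.univ.filter fun b => ¬ Q b) ∪
      ((Finset.univ.filter fun a => ¬ P a) ×ˢ Finset.univ.filter Q) ⊆
      Finset.univ.filter fun a : α × β => ¬(P a.1 ↔ Q a.2) := by
    intro a
    simp only [Finset.mem_union, Finset.mem_product, Finset.mem_filter, Finset.mem_univ, true_and]
    tauto
  refine le_trans ?_ (Finset.card_le_card hsub)
  rw [Finset.card_union_of_disjoint, Finset.card_product, Finset.card_product]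
  · have h1 := Finset.card_filter_add_card_filter_not (s := Finset.univ) P
    have h2 := Finset.card_filter_add_card_filter_not (s := Finset.univ) Q
    rw [Finset.card_univ] at h1 h2
    rw [← h2]
    have h3 : (Finset.univ.filter P).card ≤ (Finset.univ.filter fun a => ¬ P a).card := by omega
    nlinarith [Nat.mul_le_mul_right (Finset.univ.filter Q).card h3]
  · rw [Finset.disjoint_left]
    intro a
    simp only [Finset.mem_product, Finset.mem_filter, Finset.mem_univ, true_and]
    tauto

theorem countP_mem_range_eq_card {ι α : Type*} [Fintype ι] (f : ι → α)
    (hf : Function.Injective f) (l : List α) (hl : l.Nodup)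
    [DecidablePred fun a => a ∈ Set.range f] [DecidablePred fun i => f i ∈ l] :
    l.countP (fun a => a ∈ Set.range f) = (Finset.univ.filter fun i => f i ∈ l).card := by
  classical
  rw [List.countP_eq_length_filter, ← Finset.card_image_of_injective _ hf,
    ← List.toFinset_card_of_nodup (hl.filter _)]
  congr 1
  ext a
  simp only [List.mem_toFinset, List.mem_filter, Set.mem_range, decide_eq_true_eq,
    Finset.mem_image, Finset.mem_filter, Finset.mem_univ, true_and]
  constructor
  · rintro ⟨h, i, rfl⟩
    exact ⟨i, h, rfl⟩
  · rintro ⟨i, h, rfl⟩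
    exact ⟨h, i, rfl⟩

namespace BaseCase

variable {K : Type*} {m n p q : ℕ} (B : BaseCase K m n p q)

/-- The operations of different nested calls are disjoint, so the bound for one call persists. -/
theorem ncard_subs_route_le (hinj : Function.Injective B.decC.out) (h0 : 0 < m * p)
    (hq : m * p < q) (k d : ℕ) (u : B.Op (k + d)) :
    {a : (Fin d → Fin q) × ((Fin k → Fin q) × (Fin k → Fin m × Fin p)) |
      u ∈ B.subs d a.1 '' B.route k a.2.1 a.2.2}.ncard ≤ m * p * q ^ (k + 1) := by
  by_cases ho : ∃ w o, u = B.subs d w o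
  · obtain ⟨w, o, rfl⟩ := ho
    refine le_trans (Set.ncard_le_ncard (t := (fun b => (w, b)) ''
      {b : (Fin k → Fin q) × (Fin k → Fin m × Fin p) | o ∈ B.route k b.1 b.2}) ?_
        (Set.toFinite _)) ((Set.ncard_image_le (Set.toFinite _)).trans
          (B.ncard_route_le hinj h0 hq k o))
    rintro ⟨w', b⟩ ⟨o', h1, h2⟩
    obtain ⟨rfl, rfl⟩ := B.subs_inj d h2
    exact ⟨b, h1, rfl⟩
  · convert Nat.zero_le _
    refine (congrArg Set.ncard ?_).trans (Set.ncard_empty _)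
    refine Set.eq_empty_of_forall_notMem ?_
    rintro a ⟨o, _, h⟩
    exact ho ⟨_, o, h.symm⟩

/-- A set of operations with few products of each nested recursive call has a large boundary. -/
theorem card_mul_le_boundary (hdec : B.decC.graph.Connected)
    (hinj : Function.Injective B.decC.out) (h0 : 0 < m * p) (hq : m * p < q) (k d N : ℕ)
    (S : Set (B.Op (k + d))) [DecidablePred (· ∈ S)]
    (hN : ((B.power (k + d)).boundary S).encard ≤ N)
    (hS : 2 * (Finset.univ.filter fun a : (Fin d → Fin q) × (Fin k → Fin q) =>
      B.subs d a.1 (B.prodOp k a.2) ∈ S).card ≤ q ^ k) :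
    (Finset.univ.filter fun a : (Fin d → Fin q) × (Fin k → Fin q) =>
      B.subs d a.1 (B.prodOp k a.2) ∈ S).card * (m * p) ^ k ≤ N * (m * p * q ^ (k + 1)) := by
  classical
  have hfin : ((B.power (k + d)).boundary S).Finite :=
    Set.finite_of_encard_le_coe hN
  set T := Finset.univ.filter
    fun a : (Fin d → Fin q) × ((Fin k → Fin q) × (Fin k → Fin m × Fin p)) =>
      ¬(B.subs d a.1 (B.prodOp k a.2.1) ∈ S ↔ B.subs d a.1 (B.outOp k a.2.2) ∈ S) with hT
  have hsum : (Finset.univ.filter fun a : (Fin d → Fin q) × (Fin k → Fin q) =>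
      B.subs d a.1 (B.prodOp k a.2) ∈ S).card = ∑ w : Fin d → Fin q,
        (Finset.univ.filter fun x : Fin k → Fin q => B.subs d w (B.prodOp k x) ∈ S).card := by
    simp only [Finset.card_filter, Fintype.sum_prod_type]
  have hlow : (Finset.univ.filter fun a : (Fin d → Fin q) × (Fin k → Fin q) =>
      B.subs d a.1 (B.prodOp k a.2) ∈ S).card * (m * p) ^ k ≤ T.card := by
    have hTs : T.card = ∑ w : Fin d → Fin q, (Finset.univ.filter
        fun b : (Fin k → Fin q) × (Fin k → Fin m × Fin p) =>
        ¬(B.subs d w (B.prodOp k b.1) ∈ S ↔ B.subs d w (B.outOp k b.2) ∈ S)).card := by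
      simp only [hT, Finset.card_filter, Fintype.sum_prod_type]
    rw [hTs, hsum, Finset.sum_mul]
    refine Finset.sum_le_sum fun w _ => ?_
    have := card_mul_le_card_not_iff (fun x => B.subs d w (B.prodOp k x) ∈ S)
      (fun z => B.subs d w (B.outOp k z) ∈ S) ?_
    · simpa using this
    -- The half bound holds for all calls together, hence for each.
    · rw [Fintype.card_fun, Fintype.card_fin, Fintype.card_fin]
      refine le_trans (Nat.mul_le_mul le_rfl ?_) hS
      rw [hsum]
      exact Finset.single_le_sum (f := fun w => (Finset.univ.filter
        fun x : Fin k → Fin q => B.subs d w (B.prodOp k x) ∈ S).card)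
        (fun _ _ => Nat.zero_le _) (Finset.mem_univ w)
  refine hlow.trans ?_
  have hcov : T ⊆ hfin.toFinset.biUnion fun u => Finset.univ.filter
      fun a : (Fin d → Fin q) × ((Fin k → Fin q) × (Fin k → Fin m × Fin p)) =>
      u ∈ B.subs d a.1 '' B.route k a.2.1 a.2.2 := by
    rintro ⟨w, x, z⟩ ha
    have ha' := (Finset.mem_filter.1 ha).2
    have hl : Relation.ReflTransGen ((B.power (k + d)).Link (B.subs d w '' B.route k x z))
        (B.subs d w (B.prodOp k x)) (B.subs d w (B.outOp k z)) := by
      refine (B.route_linked hdec k x z).lift (B.subs d w) fun a b hab => ?_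
      obtain ⟨h1, h2, h3⟩ := hab
      exact ⟨⟨a, h1, rfl⟩, ⟨b, h2, rfl⟩,
        h3.imp (fun h => B.operand_subs h d w) (fun h => B.operand_subs h d w)⟩
    obtain ⟨u, hu, hb⟩ := Cdag.exists_mem_boundary hl ha'
    simp only [Finset.mem_biUnion, Finset.mem_filter, Finset.mem_univ, true_and]
    exact ⟨u, hfin.mem_toFinset.2 hb, hu⟩
  refine (Finset.card_le_card hcov).trans ((Finset.card_biUnion_le_card_mul _ _
    (m * p * q ^ (k + 1)) fun u _ => ?_).trans (Nat.mul_le_mul ?_ le_rfl))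
  · have := B.ncard_subs_route_le hinj h0 hq k d u
    rwa [Set.ncard_eq_toFinset_card', Set.toFinset_ofPred] at this
  · rw [hfin.encard_eq_coe_toFinset_card] at hN
    exact_mod_cast hN

end BaseCase

/-! ### Communication during a segment of a schedule -/

namespace Cdag

variable {G : Cdag} {M : ℕ}

theorem order_append (s s' : List G.Instr) : G.order (s ++ s') = G.order s ++ G.order s' :=
  List.filterMap_append

theorem words_append (s s' : List G.Instr) : G.words (s ++ s') = G.words s + G.words s' :=
  List.countP_append

theorem mem_order {s : List G.Instr} {o : G.Op} : o ∈ G.order s ↔ Instr.compute o ∈ s := by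
  simp only [order, List.mem_filterMap]
  constructor
  · rintro ⟨i, hi, h⟩
    cases i <;> simp at h
    exact h ▸ hi
  · exact fun h => ⟨_, h, rfl⟩

theorem words_cons_le (i : G.Instr) (s : List G.Instr) : G.words s ≤ G.words (i :: s) := by
  simp only [words, List.countP_cons]
  omega

theorem run_append {σ τ : G.State} {s s' : List G.Instr} :
    Run G M σ (s ++ s') τ ↔ ∃ ρ, Run G M σ s ρ ∧ Run G M ρ s' τ := by
  induction s generalizing σ with
  | nil =>
    constructor
    · exact fun h => ⟨σ, Run.nil _, h⟩
    · rintro ⟨ρ, h, h'⟩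
      cases h
      exact h'
  | cons i s ih =>
    constructor
    · intro h
      cases h with
      | cons _ ρ _ _ _ h hs =>
        obtain ⟨ρ', h1, h2⟩ := ih.1 hs
        exact ⟨ρ', Run.cons _ _ _ _ _ h h1, h2⟩
    · rintro ⟨ρ, h, h'⟩
      cases h with
      | cons _ ρ' _ _ _ h hs => exact Run.cons _ _ _ _ _ h (ih.2 ⟨ρ, hs, h'⟩)

theorem Run.encard_fast_le {σ τ : G.State} {s : List G.Instr} (h : Run G M σ s τ)
    (hσ : σ.fast.encard ≤ M) : τ.fast.encard ≤ M := by
  induction h with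
  | nil => exact hσ
  | cons σ τ ρ i s h _ ih =>
    apply ih
    cases h with
    | read F S v hv hM => exact hM
    | write F S v hv => exact hσ
    | discard F S v => exact (Set.encard_le_encard Set.sdiff_subset).trans hσ
    | compute F S o h₁ h₂ hM => exact hM

theorem Run.of_mem_fast {σ τ : G.State} {s : List G.Instr} (h : Run G M σ s τ) {v : G.Val}
    (hv : v ∈ τ.fast) :
    v ∈ σ.fast ∨ Instr.read v ∈ s ∨ ∃ o, v = Sum.inr o ∧ o ∈ G.order s := by
  simp only [mem_order]
  induction h with
  | nil => exact Or.inl hv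
  | cons σ τ ρ i s h _ ih =>
    rcases ih hv with h' | h' | ⟨o, rfl, h'⟩
    · cases h with
      | read F S w hw hM =>
        rcases h' with rfl | h'
        · exact Or.inr (Or.inl (by simp))
        · exact Or.inl h'
      | write F S w hw => exact Or.inl h'
      | discard F S w => exact Or.inl h'.1
      | compute F S o h₁ h₂ hM =>
        rcases h' with rfl | h'
        · exact Or.inr (Or.inr ⟨o, rfl, by simp⟩)
        · exact Or.inl h'
    · exact Or.inr (Or.inl (List.mem_cons_of_mem _ h'))
    · exact Or.inr (Or.inr ⟨o, rfl, List.mem_cons_of_mem _ h'⟩)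

theorem Run.of_mem_slow {σ τ : G.State} {s : List G.Instr} (h : Run G M σ s τ) {v : G.Val}
    (hv : v ∈ τ.slow) : v ∈ σ.slow ∨ Instr.write v ∈ s := by
  induction h with
  | nil => exact Or.inl hv
  | cons σ τ ρ i s h _ ih =>
    rcases ih hv with h' | h'
    · cases h with
      | read F S w hw hM => exact Or.inl h'
      | write F S w hw =>
        rcases h' with rfl | h'
        · exact Or.inr (by simp)
        · exact Or.inl h'
      | discard F S w => exact Or.inl h'
      | compute F S o h₁ h₂ hM => exact Or.inl h'
    · exact Or.inr (List.mem_cons_of_mem _ h')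

theorem Run.of_mem {σ τ : G.State} {s : List G.Instr} (h : Run G M σ s τ) {o : G.Op}
    (ho : Sum.inr o ∈ τ.fast ∪ τ.slow) : Sum.inr o ∈ σ.fast ∪ σ.slow ∨ o ∈ G.order s := by
  simp only [mem_order]
  induction h with
  | nil => exact Or.inl ho
  | cons σ τ ρ i s h _ ih =>
    rcases ih ho with h' | h'
    · cases h with
      | read F S w hw hM =>
        rcases h' with (rfl | h') | h'
        · exact Or.inl (Or.inr hw)
        · exact Or.inl (Or.inl h')
        · exact Or.inl (Or.inr h')
      | write F S w hw =>
        rcases h' with h' | rfl | h'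
        · exact Or.inl (Or.inl h')
        · exact Or.inl (Or.inl hw)
        · exact Or.inl (Or.inr h')
      | discard F S w =>
        rcases h' with h' | h'
        · exact Or.inl (Or.inl h'.1)
        · exact Or.inl (Or.inr h')
      | compute F S o' h₁ h₂ hM =>
        rcases h' with (h' | h') | h'
        · injection h' with h'
          subst h'
          exact Or.inr (by simp)
        · exact Or.inl (Or.inl h')
        · exact Or.inl (Or.inr h')
    · exact Or.inr (List.mem_cons_of_mem _ h')

/-- When an operation is performed, its operands are in fast memory. -/
theorem Run.operands {σ τ : G.State} {s : List G.Instr} (h : Run G M σ s τ) {o : G.Op}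
    (ho : o ∈ G.order s) : ∃ s₁ s₂ ρ, s = s₁ ++ Instr.compute o :: s₂ ∧ Run G M σ s₁ ρ ∧
      G.fst o ∈ ρ.fast ∧ G.snd o ∈ ρ.fast := by
  obtain ⟨s₁, s₂, rfl⟩ := List.append_of_mem (mem_order.1 ho)
  obtain ⟨ρ, h1, h2⟩ := run_append.1 h
  refine ⟨s₁, s₂, ρ, rfl, h1, ?_⟩
  cases h2 with
  | cons _ _ _ _ _ h _ =>
    cases h with
    | compute F S o h₁ h₂ hM => exact ⟨h₁, h₂⟩

theorem Run.operand_mem {σ τ : G.State} {s : List G.Instr} (h : Run G M σ s τ) {u o : G.Op}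
    (ho : o ∈ G.order s) (hu : G.Operand u o) :
    Sum.inr u ∈ σ.fast ∨ Instr.read (Sum.inr u) ∈ s ∨ u ∈ G.order s := by
  obtain ⟨s₁, s₂, ρ, rfl, h1, h2, h3⟩ := h.operands ho
  have hm : Sum.inr u ∈ ρ.fast := by
    rcases hu with hu | hu
    · exact hu ▸ h2
    · exact hu ▸ h3
  rcases h1.of_mem_fast hm with h | h | ⟨_, h, h'⟩
  · exact Or.inl h
  · exact Or.inr (Or.inl (List.mem_append_left _ h))
  · injection h with h
    subst h
    rw [order_append]
    exact Or.inr (Or.inr (List.mem_append_left _ h'))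

theorem Run.operand_available {σ τ : G.State} {s : List G.Instr} (h : Run G M σ s τ) {u o : G.Op}
    (ho : o ∈ G.order s) (hu : G.Operand u o) :
    Sum.inr u ∈ σ.fast ∪ σ.slow ∨ u ∈ G.order s := by
  obtain ⟨s₁, s₂, ρ, rfl, h1, h2, h3⟩ := h.operands ho
  have hm : Sum.inr u ∈ ρ.fast := by
    rcases hu with hu | hu
    · exact hu ▸ h2
    · exact hu ▸ h3
  rcases h1.of_mem (Or.inl hm) with h | h
  · exact Or.inl h
  · rw [order_append]
    exact Or.inr (List.mem_append_left _ h)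

/-- The values transferred by a list of instructions. -/
def transferred (s : List G.Instr) : Set G.Val :=
  {v | Instr.read v ∈ s ∨ Instr.write v ∈ s}

theorem encard_transferred_le (s : List G.Instr) : (transferred s).encard ≤ G.words s := by
  induction s with
  | nil => simp [transferred, words]
  | cons i s ih =>
    have key : ∀ v, (i = Instr.read v ∨ i = Instr.write v) →
        (transferred (i :: s)).encard ≤ G.words (i :: s) := by
      intro v hi
      have h1 : transferred (i :: s) ⊆ insert v (transferred s) := by
        intro w hw
        rcases hi with rfl | rfl <;> simp only [transferred, List.mem_cons, Set.mem_ofPred_eq,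
          Instr.read.injEq, Instr.write.injEq, reduceCtorEq, false_or] at hw ⊢ <;>
          simp only [Set.mem_insert_iff, Set.mem_ofPred_eq] <;> tauto
      have h2 : G.words (i :: s) = G.words s + 1 := by
        rcases hi with rfl | rfl <;> simp [words]
      rw [h2]
      refine (Set.encard_le_encard h1).trans ((Set.encard_insert_le _ _).trans ?_)
      push_cast
      exact add_le_add_left ih 1
    have key' : transferred (i :: s) = transferred s →
        (transferred (i :: s)).encard ≤ G.words (i :: s) := by
      intro h
      rw [h]
      exact ih.trans (by exact_mod_cast words_cons_le i s)
    cases i with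
    | read v => exact key v (Or.inl rfl)
    | write v => exact key v (Or.inr rfl)
    | discard v => exact key' (by simp [transferred])
    | compute o => exact key' (by simp [transferred])

/-- The boundary of the set of operations of a segment of a schedule is limited by the size of
the fast memory and the communication during the segment. -/
theorem encard_boundary_le {s₀ s₁ s₂ : List G.Instr} (h : G.IsSchedule M (s₀ ++ s₁ ++ s₂)) :
    (G.boundary {o | o ∈ G.order s₁}).encard ≤ (2 * M + G.words s₁ : ℕ) := by
  obtain ⟨⟨τ, hrun, -⟩, hnd, hall⟩ := h
  obtain ⟨σ₂, hrun', h₂⟩ := run_append.1 hrun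
  obtain ⟨σ₁, h₀, h₁⟩ := run_append.1 hrun'
  have hf1 : σ₁.fast.encard ≤ M := h₀.encard_fast_le (by simp)
  have hf2 : σ₂.fast.encard ≤ M := h₁.encard_fast_le hf1
  rw [order_append, order_append, List.nodup_append, List.nodup_append] at hnd
  obtain ⟨⟨-, -, hd01⟩, -, hd2⟩ := hnd
  have hd01 : ∀ u, u ∈ G.order s₀ → u ∉ G.order s₁ := fun u h h' => hd01 u h u h' rfl
  have hd12 : ∀ u, u ∈ G.order s₁ → u ∉ G.order s₂ := fun u h h' =>
    hd2 u (List.mem_append_right _ h) u h' rfl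
  -- Since nothing is recomputed, a value produced in the segment is in neither memory when the
  -- segment begins.
  have hav : ∀ u, u ∈ G.order s₁ → Sum.inr u ∉ σ₁.fast ∪ σ₁.slow := by
    intro u hu h
    rcases h₀.of_mem h with (h | h) | h
    · exact h
    · obtain ⟨_, h⟩ := h
      cases h
    · exact hd01 u h hu
  have hsub : Sum.inr '' G.boundary {o | o ∈ G.order s₁} ⊆
      σ₁.fast ∪ σ₂.fast ∪ transferred s₁ := by
    rintro _ ⟨u, ⟨v, huv, hne⟩, rfl⟩
    simp only [Set.mem_ofPred_eq] at hne
    -- An operand entering the segment is in fast memory at its start or is read. One leaving it is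
    -- used later, so it is in fast memory at the end or is written.
    by_cases hv : v ∈ G.order s₁
    · have hu : u ∉ G.order s₁ := fun h => hne ⟨fun _ => hv, fun _ => h⟩
      rcases h₁.operand_mem hv huv with h | h | h
      · exact Or.inl (Or.inl h)
      · exact Or.inr (Or.inl h)
      · exact absurd h hu
    · have hu : u ∈ G.order s₁ := by_contra fun h => hne ⟨fun h' => absurd h' h,
        fun h' => absurd h' hv⟩
      have hv' := hall v
      rw [order_append, order_append, List.mem_append, List.mem_append] at hv'
      rcases hv' with (h | h) | h
      · rcases h₀.operand_available h huv with (h | h) | h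
        · exact absurd h (by simp)
        · obtain ⟨_, h⟩ := h
          cases h
        · exact absurd hu (hd01 u h)
      · exact absurd h hv
      · rcases h₂.operand_available h huv with (h | h) | h
        · exact Or.inl (Or.inr h)
        · rcases h₁.of_mem_slow h with h | h
          · exact absurd (Or.inr h) (hav u hu)
          · exact Or.inr (Or.inr h)
        · exact absurd h (hd12 u hu)
  rw [← Sum.inr_injective.encard_image]
  refine (Set.encard_le_encard hsub).trans ((Set.encard_union_le _ _).trans ?_)
  push_cast
  refine add_le_add ((Set.encard_union_le _ _).trans ?_) (encard_transferred_le s₁)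
  rw [two_mul]
  exact add_le_add hf1 hf2

theorem exists_segment (P : G.Op → Prop) [DecidablePred P] (s : List G.Instr) (L : ℕ)
    (hL : L ≤ (G.order s).countP P) :
    ∃ s₁ s₂, s = s₁ ++ s₂ ∧ (G.order s₁).countP P = L := by
  induction s generalizing L with
  | nil => exact ⟨[], [], rfl, by simpa [order] using hL.antisymm' (Nat.zero_le _)⟩
  | cons i s ih =>
    have key : ∀ j : ℕ, (∀ s', (G.order (i :: s')).countP P = (G.order s').countP P + j) →
        j ≤ L → ∃ s₁ s₂, i :: s = s₁ ++ s₂ ∧ (G.order s₁).countP P = L := by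
      intro j hj hjL
      rw [hj] at hL
      obtain ⟨s₁, s₂, rfl, h⟩ := ih (L - j) (by omega)
      exact ⟨i :: s₁, s₂, rfl, by rw [hj, h]; omega⟩
    cases i with
    | read v => exact key 0 (fun _ => rfl) (Nat.zero_le _)
    | write v => exact key 0 (fun _ => rfl) (Nat.zero_le _)
    | discard v => exact key 0 (fun _ => rfl) (Nat.zero_le _)
    | compute o =>
      rcases Nat.eq_zero_or_pos L with rfl | h0
      · exact ⟨[], _, rfl, rfl⟩
      · have hc : ∀ s', G.order (Instr.compute o :: s') = o :: G.order s' := fun _ => rfl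
        by_cases ho : P o
        · exact key 1 (fun s' => by rw [hc, List.countP_cons_of_pos (by simpa using ho)]) h0
        · exact key 0 (fun s' => by rw [hc, List.countP_cons_of_neg (by simpa using ho)]; rfl)
            (Nat.zero_le _)

/-- If every segment with `L` operations of a given kind communicates `W` words, then so many
words are communicated as there are disjoint segments. -/
theorem mul_le_words_of_segments (P : G.Op → Prop) [DecidablePred P] (L W : ℕ)
    (s : List G.Instr)
    (hseg : ∀ s₀ s₁ s₂, s = s₀ ++ s₁ ++ s₂ → (G.order s₁).countP P = L → W ≤ G.words s₁)
    (N : ℕ) (s₀ s' : List G.Instr) (hs : s = s₀ ++ s') (hN : L * N ≤ (G.order s').countP P) :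
    W * N ≤ G.words s' := by
  induction N generalizing s₀ s' with
  | zero => simp
  | succ N ih =>
    obtain ⟨s₁, s₂, rfl, h⟩ := exists_segment P s' L (le_trans (by nlinarith) hN)
    rw [order_append, List.countP_append, h] at hN
    have h1 := hseg s₀ s₁ s₂ (by rw [hs, List.append_assoc]) h
    have h2 := ih (s₀ ++ s₁) s₂ (by rw [hs, List.append_assoc])
      (by rw [mul_add] at hN; omega)
    rw [words_append]
    nlinarith

end Cdag

/-! ### Lower bounds in integers -/

namespace BaseCase

variable {K : Type*} {m n p q : ℕ} (B : BaseCase K m n p q)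

/-- The `q ^ (d + j + 1)` products are cut into segments of `q ^ j`. Calls of power `j + 1`, one
more than `j`, ensure that a segment has at most half the products of any call. The boundary
estimate then yields `3 * M ≤ 2 * M + w` for the words `w` of a segment. -/
theorem mul_pow_le_words (hdec : B.decC.graph.Connected)
    (hinj : Function.Injective B.decC.out) (h0 : 1 < m * p) (hq : m * p < q) {j d M : ℕ}
    (hM : 3 * q ^ 2 * M ≤ (m * p) ^ j) {s : List (B.power (j + 1 + d)).Instr}
    (hs : (B.power (j + 1 + d)).IsSchedule M s) : M * q ^ (d + 1) ≤ (B.power (j + 1 + d)).words s := by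
  classical
  let f : (Fin d → Fin q) × (Fin (j + 1) → Fin q) → B.Op (j + 1 + d) :=
    fun a => B.subs d a.1 (B.prodOp (j + 1) a.2)
  have hf : Function.Injective f := by
    rintro ⟨w, x⟩ ⟨w', x'⟩ h
    obtain ⟨h1, h2⟩ := B.subs_inj d h
    exact Prod.ext h1 (B.prodOp_injective _ h2)
  have hq0 : 0 < q ^ j := pow_pos (by omega) _
  refine Cdag.mul_le_words_of_segments (G := B.power (j + 1 + d))
    (fun o : B.Op (j + 1 + d) => o ∈ Set.range f) (q ^ j) M s ?_ _ [] s rfl ?_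
  · rintro s₀ s₁ s₂ rfl hc
    have hU := Cdag.encard_boundary_le hs
    have hnd := hs.2.1
    rw [Cdag.order_append, Cdag.order_append, List.nodup_append, List.nodup_append] at hnd
    rw [countP_mem_range_eq_card f hf _ hnd.1.2.1] at hc
    have h1 := B.card_mul_le_boundary hdec hinj (by omega) hq (j + 1) d _
      {o | o ∈ (B.power (j + 1 + d)).order s₁} hU ?_
    · have hc' : (Finset.univ.filter fun a : (Fin d → Fin q) × (Fin (j + 1) → Fin q) =>
          B.subs d a.1 (B.prodOp (j + 1) a.2) ∈
            {o | o ∈ (B.power (j + 1 + d)).order s₁}).card = q ^ j := by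
        rw [← hc]
        congr
      rw [hc'] at h1
      set w := (B.power (j + 1 + d)).words s₁
      have h2 : (m * p) ^ j ≤ (2 * M + w) * q ^ 2 := by
        have hpos : 0 < q ^ j * (m * p) := Nat.mul_pos hq0 (by omega)
        refine Nat.le_of_mul_le_mul_left ?_ hpos
        calc q ^ j * (m * p) * (m * p) ^ j = q ^ j * (m * p) ^ (j + 1) := by ring
          _ ≤ _ := h1
          _ = _ := by ring
      have h3 : q ^ 2 * (3 * M) ≤ q ^ 2 * (2 * M + w) := by
        calc q ^ 2 * (3 * M) = 3 * q ^ 2 * M := by ring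
          _ ≤ _ := hM.trans h2
          _ = _ := by ring
      have := Nat.le_of_mul_le_mul_left h3 (pow_pos (by omega) _)
      omega
    · have hc' : (Finset.univ.filter fun a : (Fin d → Fin q) × (Fin (j + 1) → Fin q) =>
          B.subs d a.1 (B.prodOp (j + 1) a.2) ∈
            {o | o ∈ (B.power (j + 1 + d)).order s₁}).card = q ^ j := by
        rw [← hc]
        congr
      rw [hc', pow_succ, mul_comm]
      exact Nat.mul_le_mul le_rfl (by omega)
  · rw [countP_mem_range_eq_card f hf _ hs.2.1, Finset.filter_true_of_mem fun a _ => hs.2.2 _]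
    simp only [Finset.card_univ, Fintype.card_prod, Fintype.card_fun, Fintype.card_fin]
    exact le_of_eq (by ring)

/-- The outputs are distinct results of operations, none initially in slow memory, so each is
written. -/
theorem pow_le_words (hinj : Function.Injective B.decC.out) {t M : ℕ}
    {s : List (B.power t).Instr} (hs : (B.power t).IsSchedule M s) :
    (m * p) ^ t ≤ (B.power t).words s := by
  obtain ⟨⟨τ, hrun, hout⟩, -, -⟩ := hs
  have hsub : Set.range (B.outC t) ⊆ Cdag.transferred s := by
    rintro _ ⟨z, rfl⟩
    rcases hrun.of_mem_slow (hout ⟨z, rfl⟩) with h | h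
    · obtain ⟨_, h⟩ := h
      rw [B.outC_eq] at h
      cases h
    · exact Or.inr h
  have h1 := (Set.encard_le_encard hsub).trans (Cdag.encard_transferred_le s)
  have h2 : Function.Injective (B.outC t) := by
    intro z z' h
    rw [B.outC_eq, B.outC_eq] at h
    exact B.outOp_injective hinj t (Sum.inr_injective h)
  rw [← Set.image_univ, h2.encard_image, Set.encard_univ, ENat.card_eq_coe_fintype_card] at h1
  simp only [Fintype.card_fun, Fintype.card_prod, Fintype.card_fin] at h1
  exact_mod_cast h1

end BaseCase

/-! ### Building executions -/

namespace Cdag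

variable {G : Cdag} {M : ℕ}

/-- The operations of a list can be performed in order, starting from the values in `A`. -/
def Ready (G : Cdag) : Set G.Val → List G.Op → Prop
  | _, [] => True
  | A, o :: L => G.fst o ∈ A ∧ G.snd o ∈ A ∧ Ready G (insert (Sum.inr o) A) L

theorem ready_map_of_pairwise {ι : Type*} (f : ι → G.Op) (rk : ι → ℕ) (l : List ι)
    (hl : l.Pairwise fun a b => rk a ≤ rk b) (A : Set G.Val)
    (h : ∀ a ∈ l, ∀ v, v = G.fst (f a) ∨ v = G.snd (f a) →
      v ∈ A ∨ ∃ b ∈ l, v = Sum.inr (f b) ∧ rk b < rk a) : G.Ready A (l.map f) := by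
  induction l generalizing A with
  | nil => trivial
  | cons a l ih =>
    rw [List.pairwise_cons] at hl
    have hhead : ∀ v, v = G.fst (f a) ∨ v = G.snd (f a) → v ∈ A := by
      intro v hv
      rcases h a (by simp) v hv with h' | ⟨b, hb, -, hlt⟩
      · exact h'
      · rcases List.mem_cons.1 hb with rfl | hb
        · exact absurd hlt (lt_irrefl _)
        · exact absurd (hl.1 b hb) (by omega)
    refine ⟨hhead _ (Or.inl rfl), hhead _ (Or.inr rfl), ih hl.2 _ fun a' ha' v hv => ?_⟩
    rcases h a' (by simp [ha']) v hv with h' | ⟨b, hb, rfl, hlt⟩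
    · exact Or.inl (Or.inr h')
    · rcases List.mem_cons.1 hb with rfl | hb
      · exact Or.inl (Or.inl rfl)
      · exact Or.inr ⟨b, hb, rfl, hlt⟩

theorem Ready.mono {A A' : Set G.Val} {L : List G.Op} (h : G.Ready A L) (hA : A ⊆ A') :
    G.Ready A' L := by
  induction L generalizing A A' with
  | nil => trivial
  | cons o L ih => exact ⟨hA h.1, hA h.2.1, ih h.2.2 (Set.insert_subset_insert hA)⟩

/-- Execution of the operations `L` in order with a communication of at most `w` words. -/
def Exec (G : Cdag) (M : ℕ) (σ : G.State) (L : List G.Op) (w : ℕ) (τ : G.State) : Prop :=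
  ∃ s, Run G M σ s τ ∧ G.order s = L ∧ G.words s ≤ w

theorem Exec.trans {σ τ ρ : G.State} {L L' : List G.Op} {w w' : ℕ} (h : G.Exec M σ L w τ)
    (h' : G.Exec M τ L' w' ρ) : G.Exec M σ (L ++ L') (w + w') ρ := by
  obtain ⟨s, h1, h2, h3⟩ := h
  obtain ⟨s', h1', h2', h3'⟩ := h'
  refine ⟨s ++ s', run_append.2 ⟨_, h1, h1'⟩, by rw [order_append, h2, h2'], ?_⟩
  rw [words_append]
  exact Nat.add_le_add h3 h3'

theorem Exec.refl (σ : G.State) : G.Exec M σ [] 0 σ := ⟨[], Run.nil _, rfl, le_rfl⟩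

theorem Exec.of_step {σ τ ρ : G.State} {i : G.Instr} {L : List G.Op} {w : ℕ}
    (h : Step G M σ i τ) (h' : G.Exec M τ L w ρ) :
    G.Exec M σ (G.order [i] ++ L) (G.words [i] + w) ρ :=
  Exec.trans ⟨[i], Run.cons _ _ _ _ _ h (Run.nil _), rfl, le_rfl⟩ h'

theorem Exec.compute {F S : Set G.Val} {τ : G.State} {o : G.Op} {L : List G.Op} {w : ℕ}
    (h₁ : G.fst o ∈ F) (h₂ : G.snd o ∈ F) (hM : (insert (Sum.inr o) F).encard ≤ M)
    (h : G.Exec M ⟨insert (Sum.inr o) F, S⟩ L w τ) : G.Exec M ⟨F, S⟩ (o :: L) w τ := by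
  have := h.of_step (Step.compute F S o h₁ h₂ hM)
  simpa [order, words] using this

theorem Exec.read {F S : Set G.Val} {τ : G.State} {v : G.Val} {L : List G.Op} {w : ℕ}
    (hv : v ∈ S) (hM : (insert v F).encard ≤ M) (h : G.Exec M ⟨insert v F, S⟩ L w τ) :
    G.Exec M ⟨F, S⟩ L (w + 1) τ := by
  have := h.of_step (Step.read F S v hv hM)
  simpa [order, words, add_comm] using this

theorem Exec.write {F S : Set G.Val} {τ : G.State} {v : G.Val} {L : List G.Op} {w : ℕ}
    (hv : v ∈ F) (h : G.Exec M ⟨F, insert v S⟩ L w τ) : G.Exec M ⟨F, S⟩ L (w + 1) τ := by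
  have := h.of_step (Step.write F S v hv)
  simpa [order, words, add_comm] using this

theorem Exec.discard {F S : Set G.Val} {τ : G.State} (v : G.Val) {L : List G.Op} {w : ℕ}
    (h : G.Exec M ⟨F \ {v}, S⟩ L w τ) : G.Exec M ⟨F, S⟩ L w τ := by
  have := h.of_step (Step.discard F S v)
  simpa [order, words] using this

theorem exec_compute {F S : Set G.Val} {L : List G.Op} (hL : G.Ready F L)
    (hM : F.encard + L.length ≤ M) :
    G.Exec M ⟨F, S⟩ L 0 ⟨F ∪ Sum.inr '' {o | o ∈ L}, S⟩ := by
  induction L generalizing F with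
  | nil => simpa using Exec.refl _
  | cons o L ih =>
    have hc : (insert (Sum.inr o) F).encard + L.length ≤ M := by
      refine le_trans (add_le_add_left (Set.encard_insert_le _ _) _) (le_trans (le_of_eq ?_) hM)
      push_cast [List.length_cons]
      ring
    refine Exec.compute hL.1 hL.2.1 (le_self_add.trans hc) ?_
    convert ih hL.2.2 hc using 2
    ext v
    simp only [Set.mem_union, Set.mem_image, Set.mem_ofPred_eq, List.mem_cons, Set.mem_insert_iff]
    constructor
    · rintro (h | ⟨o', rfl | h, rfl⟩)
      · exact Or.inl (Or.inr h)
      · exact Or.inl (Or.inl rfl)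
      · exact Or.inr ⟨o', h, rfl⟩
    · rintro ((rfl | h) | ⟨o', h, rfl⟩)
      · exact Or.inr ⟨o, Or.inl rfl, rfl⟩
      · exact Or.inl h
      · exact Or.inr ⟨o', Or.inr h, rfl⟩

theorem exec_discard (F S : Set G.Val) (l : List G.Val) :
    G.Exec M ⟨F, S⟩ [] 0 ⟨F \ {v | v ∈ l}, S⟩ := by
  induction l generalizing F with
  | nil => simpa using Exec.refl _
  | cons v l ih =>
    refine Exec.discard v ?_
    convert ih _ using 2
    ext w
    simp only [Set.mem_sdiff, Set.mem_ofPred_eq, List.mem_cons, Set.mem_singleton_iff]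
    tauto

theorem exec_read {F S : Set G.Val} {l : List G.Val} (hl : ∀ v ∈ l, v ∈ S)
    (hM : F.encard + l.length ≤ M) :
    G.Exec M ⟨F, S⟩ [] l.length ⟨F ∪ {v | v ∈ l}, S⟩ := by
  induction l generalizing F with
  | nil => simpa using Exec.refl _
  | cons v l ih =>
    have hc : (insert v F).encard + l.length ≤ M := by
      refine le_trans (add_le_add_left (Set.encard_insert_le _ _) _) (le_trans (le_of_eq ?_) hM)
      push_cast [List.length_cons]
      ring
    refine Exec.read (hl v (by simp)) (le_self_add.trans hc) ?_
    convert ih (fun w hw => hl w (by simp [hw])) hc using 2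
    ext w
    simp only [Set.mem_union, Set.mem_ofPred_eq, List.mem_cons, Set.mem_insert_iff]
    tauto

theorem exec_write {F S : Set G.Val} {l : List G.Val} (hl : ∀ v ∈ l, v ∈ F) :
    G.Exec M ⟨F, S⟩ [] l.length ⟨F, S ∪ {v | v ∈ l}⟩ := by
  induction l generalizing S with
  | nil => simpa using Exec.refl _
  | cons v l ih =>
    refine Exec.write (hl v (by simp)) ?_
    convert ih (S := insert v S) (fun w hw => hl w (by simp [hw])) using 2
    ext w
    simp only [Set.mem_union, Set.mem_ofPred_eq, List.mem_cons, Set.mem_insert_iff]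
    tauto

/-- Operations can be performed one by one with three words of communication each. -/
theorem exec_external {S : Set G.Val} {L : List G.Op} (hL : G.Ready S L) (hM : 3 ≤ M) :
    G.Exec M ⟨∅, S⟩ L (3 * L.length) ⟨∅, S ∪ Sum.inr '' {o | o ∈ L}⟩ := by
  induction L generalizing S with
  | nil => simpa using Exec.refl _
  | cons o L ih =>
    have hins : ∀ (F : Set G.Val) (v : G.Val) (k : ℕ), F.encard ≤ k →
        (insert v F).encard ≤ (k + 1 : ℕ) := by
      intro F v k h
      refine (Set.encard_insert_le _ _).trans ?_
      push_cast
      exact add_le_add_left h 1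
    have hle : ∀ k : ℕ, k ≤ 3 → (k : ℕ∞) ≤ M := fun k hk => by exact_mod_cast hk.trans hM
    have h1 := hins ∅ (G.fst o) 0 (by simp)
    have h2 := hins _ (G.snd o) _ h1
    have h3 := hins _ (Sum.inr o) _ h2
    rw [show 3 * (o :: L).length = 3 * L.length + 1 + 1 + 1 by rw [List.length_cons]; ring]
    refine Exec.read hL.1 (h1.trans (hle _ (by norm_num))) ?_
    refine Exec.read hL.2.1 (h2.trans (hle _ (by norm_num))) ?_
    refine Exec.compute (by simp) (by simp) (h3.trans (hle _ (by norm_num))) ?_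
    refine Exec.write (v := Sum.inr o) (by simp) ?_
    refine Exec.discard (Sum.inr o) (Exec.discard (G.fst o) (Exec.discard (G.snd o) ?_))
    convert ih hL.2.2 using 2
    · ext v
      simp only [Set.mem_sdiff, Set.mem_insert_iff, Set.mem_singleton_iff, Set.mem_empty_iff_false]
      tauto
    · ext v
      simp only [Set.mem_union, Set.mem_image, Set.mem_ofPred_eq, List.mem_cons,
        Set.mem_insert_iff]
      constructor
      · rintro (h | ⟨o', rfl | h, rfl⟩)
        · exact Or.inl (Or.inr h)
        · exact Or.inl (Or.inl rfl)
        · exact Or.inr ⟨o', h, rfl⟩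
      · rintro ((rfl | h) | ⟨o', h, rfl⟩)
        · exact Or.inr ⟨o, Or.inl rfl, rfl⟩
        · exact Or.inl h
        · exact Or.inr ⟨o', Or.inr h, rfl⟩

theorem encard_image_mem_list_le (L : List G.Op) :
    (Sum.inr '' {o | o ∈ L} : Set G.Val).encard ≤ L.length := by
  classical
  refine (Set.encard_image_le _ _).trans ?_
  have : {o | o ∈ L} = (L.toFinset : Set G.Op) := by ext; simp
  rw [this, Set.encard_coe_eq_coe_finsetCard]
  exact_mod_cast L.toFinset_card_le

end Cdag

/-! ### The naive order of operations -/

theorem exists_layer (N : ℕ) (X : Type*) [Fintype X] :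
    ∃ l : List (Fin N × X), l.Nodup ∧ (∀ a, a ∈ l) ∧
      l.Pairwise fun a b => a.1.val ≤ b.1.val := by
  classical
  refine ⟨(Finset.univ.toList : List (Fin N × X)).insertionSort
    fun a b => a.1.val ≤ b.1.val, ?_, ?_, ?_⟩
  · exact (List.perm_insertionSort _ _).nodup_iff.2 (Finset.nodup_toList _)
  · intro a
    rw [(List.perm_insertionSort _ _).mem_iff]
    simp
  · have : Std.Total fun a b : Fin N × X => a.1.val ≤ b.1.val := ⟨fun a b => le_total _ _⟩
    have : IsTrans (Fin N × X) fun a b => a.1.val ≤ b.1.val := ⟨fun _ _ _ => le_trans⟩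
    exact List.pairwise_insertionSort _ _

/-- The operations of a program with `N` operations, applied to all entries of blocks indexed by
`X`, in straight-line order. -/
noncomputable def layer (N : ℕ) (X : Type*) [Fintype X] : List (Fin N × X) :=
  (exists_layer N X).choose

theorem nodup_layer (N : ℕ) (X : Type*) [Fintype X] : (layer N X).Nodup :=
  (exists_layer N X).choose_spec.1

theorem mem_layer {N : ℕ} {X : Type*} [Fintype X] (a : Fin N × X) : a ∈ layer N X :=
  (exists_layer N X).choose_spec.2.1 a

theorem length_layer (N : ℕ) (X : Type*) [Fintype X] :
    (layer N X).length = N * Fintype.card X := by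
  classical
  rw [← List.toFinset_card_of_nodup (nodup_layer N X),
    Finset.eq_univ_of_forall fun a => List.mem_toFinset.2 (mem_layer a)]
  simp

theorem ready_layer {K ι κ X : Type*} [Fintype X] (c : LinCircuit K ι κ) (G : Cdag)
    (val : X → ι ⊕ Fin c.size → G.Val) (op : Fin c.size → X → G.Op)
    (hval : ∀ x g, val x (Sum.inr g) = Sum.inr (op g x))
    (hfst : ∀ g x, G.fst (op g x) = val x (c.fst g))
    (hsnd : ∀ g x, G.snd (op g x) = val x (c.snd g))
    (A : Set G.Val) (hA : ∀ x i, val x (Sum.inl i) ∈ A) :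
    G.Ready A ((layer c.size X).map fun a => op a.1 a.2) := by
  refine Cdag.ready_map_of_pairwise _ (fun a => a.1.val) _
    (exists_layer c.size X).choose_spec.2.2 A ?_
  rintro ⟨g, x⟩ - v hv
  have key : ∀ u : ι ⊕ Fin c.size, v = val x u → (∀ h, u = Sum.inr h → h < g) →
      v ∈ A ∨ ∃ b ∈ layer c.size X, v = Sum.inr (op b.1 b.2) ∧ b.1.val < g.val := by
    rintro (i | h) rfl hlt
    · exact Or.inl (hA x i)
    · exact Or.inr ⟨(h, x), mem_layer _, hval x h, hlt h rfl⟩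
  rcases hv with rfl | rfl
  · exact key _ (hfst g x) (c.fst_lt g)
  · exact key _ (hsnd g x) (c.snd_lt g)

namespace BaseCase

variable {K : Type*} {m n p q : ℕ} (B : BaseCase K m n p q)

/-- The operations in the order of the naive recursive algorithm. -/
noncomputable def naiveList : (t : ℕ) → List (B.Op t)
  | 0 => [Op.prod]
  | t + 1 => (layer B.encA.size (Fin t → Fin m × Fin n)).map (fun a => Op.encA a.1 a.2) ++
      (layer B.encB.size (Fin t → Fin n × Fin p)).map (fun a => Op.encB a.1 a.2) ++
      (List.ofFn fun r => (naiveList t).map (Op.sub r)).flatten ++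
      (layer B.decC.size (Fin t → Fin m × Fin p)).map fun a => Op.decC a.1 a.2

theorem isNaiveOrder_naiveList : ∀ t, B.IsNaiveOrder t (B.naiveList t)
  | 0 => trivial
  | t + 1 => by
    refine ⟨_, _, fun _ => B.naiveList t, rfl, ?_, ?_, fun _ => isNaiveOrder_naiveList t⟩
    · intro o ho
      rw [List.mem_append, List.mem_map, List.mem_map] at ho
      rcases ho with ⟨a, -, rfl⟩ | ⟨a, -, rfl⟩
      · exact Or.inl ⟨_, _, rfl⟩
      · exact Or.inr ⟨_, _, rfl⟩
    · intro o ho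
      obtain ⟨a, -, rfl⟩ := List.mem_map.1 ho
      exact ⟨_, _, rfl⟩

theorem mem_naiveList : ∀ {t : ℕ} (o : B.Op t), o ∈ B.naiveList t
  | _, Op.prod => by simp [naiveList]
  | _, Op.encA g x => by
    simp only [naiveList, List.mem_append, List.mem_map]
    exact Or.inl (Or.inl (Or.inl ⟨(g, x), mem_layer _, rfl⟩))
  | _, Op.encB g x => by
    simp only [naiveList, List.mem_append, List.mem_map]
    exact Or.inl (Or.inl (Or.inr ⟨(g, x), mem_layer _, rfl⟩))
  | _, Op.sub r o => by
    simp only [naiveList, List.mem_append, List.mem_flatten, List.mem_ofFn]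
    exact Or.inl (Or.inr ⟨_, ⟨r, rfl⟩, List.mem_map.2 ⟨o, mem_naiveList o, rfl⟩⟩)
  | _, Op.decC g x => by
    simp only [naiveList, List.mem_append, List.mem_map]
    exact Or.inr ⟨(g, x), mem_layer _, rfl⟩

theorem nodup_naiveList : ∀ t, (B.naiveList t).Nodup
  | 0 => by simp [naiveList]
  | t + 1 => by
    have hA : ((layer B.encA.size (Fin t → Fin m × Fin n)).map
        fun a => (Op.encA a.1 a.2 : B.Op (t + 1))).Nodup :=
      (nodup_layer _ _).map fun a b h => by
        simp only [Op.encA.injEq] at h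
        exact Prod.ext h.1 h.2
    have hB : ((layer B.encB.size (Fin t → Fin n × Fin p)).map
        fun a => (Op.encB a.1 a.2 : B.Op (t + 1))).Nodup :=
      (nodup_layer _ _).map fun a b h => by
        simp only [Op.encB.injEq] at h
        exact Prod.ext h.1 h.2
    have hC : ((layer B.decC.size (Fin t → Fin m × Fin p)).map
        fun a => (Op.decC a.1 a.2 : B.Op (t + 1))).Nodup :=
      (nodup_layer _ _).map fun a b h => by
        simp only [Op.decC.injEq] at h
        exact Prod.ext h.1 h.2
    have hS : ((List.ofFn fun r => (B.naiveList t).map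
        (Op.sub r : B.Op t → B.Op (t + 1))).flatten).Nodup := by
      rw [List.nodup_flatten]
      constructor
      · intro l hl
        obtain ⟨r, rfl⟩ := List.mem_ofFn.1 hl
        exact (nodup_naiveList t).map fun a b h => by simpa using h
      · rw [List.pairwise_ofFn]
        intro r r' hr o h h'
        obtain ⟨_, -, rfl⟩ := List.mem_map.1 h
        obtain ⟨_, -, h⟩ := List.mem_map.1 h'
        injection h with _ h
        exact hr.ne h.symm
    rw [naiveList]
    refine ((hA.append hB ?_).append hS ?_).append hC ?_ <;>
      (intro o h h'
       simp only [List.mem_append, List.mem_map, List.mem_flatten, List.mem_ofFn] at h h')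
    · obtain ⟨_, -, rfl⟩ := h
      simp at h'
    · obtain ⟨_, ⟨r, rfl⟩, h'⟩ := h'
      obtain ⟨_, -, rfl⟩ := List.mem_map.1 h'
      simp at h
    · obtain ⟨_, -, rfl⟩ := h'
      simp at h

theorem vertexA_inj {t : ℕ} {x x' : Fin t → Fin m × Fin n} {v : (Fin m × Fin n) ⊕ Fin B.encA.size}
    (h : B.vertexA x v = B.vertexA x' v) : x = x' := by
  rcases v with i | g
  · simp only [vertexA, Sum.inl.injEq] at h
    exact (Fin.cons_inj.1 h).2
  · simp only [vertexA, Sum.inr.injEq, Op.encA.injEq] at h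
    exact h.2

theorem vertexB_inj {t : ℕ} {x x' : Fin t → Fin n × Fin p} {v : (Fin n × Fin p) ⊕ Fin B.encB.size}
    (h : B.vertexB x v = B.vertexB x' v) : x = x' := by
  rcases v with i | g
  · simp only [vertexB, Sum.inl.injEq, Sum.inr.injEq] at h
    exact (Fin.cons_inj.1 h).2
  · simp only [vertexB, Sum.inr.injEq, Op.encB.injEq] at h
    exact h.2

theorem vertexA_ne_vertexB {t : ℕ} (x : Fin t → Fin m × Fin n) (y : Fin t → Fin n × Fin p)
    (v : (Fin m × Fin n) ⊕ Fin B.encA.size) (w : (Fin n × Fin p) ⊕ Fin B.encB.size) :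
    B.vertexA x v ≠ B.vertexB y w := by
  rcases v with i | g <;> rcases w with j | h <;> simp [vertexA, vertexB]

/-- This is for one fixed call: different calls may share an encoded block. -/
theorem embed_injective {t : ℕ} (r : Fin q) : Function.Injective (B.embed (t := t) r) := by
  have hA : ∀ (x : Fin t → Fin m × Fin n) v o, B.vertexA x v ≠ Sum.inr (Op.sub r o) := by
    rintro x (i | g) o <;> simp [vertexA]
  have hB : ∀ (x : Fin t → Fin n × Fin p) v o, B.vertexB x v ≠ Sum.inr (Op.sub r o) := by
    rintro x (i | g) o <;> simp [vertexB]
  rintro ((x | y) | o) ((x' | y') | o') h <;> simp only [embed] at h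
  · rw [B.vertexA_inj h]
  · exact absurd h (B.vertexA_ne_vertexB _ _ _ _)
  · exact absurd h (hA _ _ _)
  · exact absurd h.symm (B.vertexA_ne_vertexB _ _ _ _)
  · rw [B.vertexB_inj h]
  · exact absurd h (hB _ _ _)
  · exact absurd h.symm (hA _ _ _)
  · exact absurd h.symm (hB _ _ _)
  · simp only [Sum.inr.injEq, Op.sub.injEq, true_and] at h
    rw [h]

end BaseCase

/-! ### Execution of the naive algorithm -/

namespace BaseCase

variable {K : Type*} {m n p q : ℕ}

/-- An occurrence of the computation of the algorithm for power `t` inside a larger one. -/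
structure Placement (B : BaseCase K m n p q) (t : ℕ) (G : Cdag) where
  val : B.Vertex t → G.Val
  op : B.Op t → G.Op
  inj : Function.Injective val
  val_op : ∀ o, val (Sum.inr o) = Sum.inr (op o)
  fst_op : ∀ o, G.fst (op o) = val (B.opFst o)
  snd_op : ∀ o, G.snd (op o) = val (B.opSnd o)

/-- The whole computation. -/
def Placement.id (B : BaseCase K m n p q) (t : ℕ) : Placement B t (B.power t) where
  val := fun v => v
  op := fun o => o
  inj := fun _ _ h => h
  val_op := fun _ => rfl
  fst_op := fun _ => rfl
  snd_op := fun _ => rfl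

variable {B : BaseCase K m n p q} {G : Cdag} {M t : ℕ}

/-- The occurrence of the `r`th recursive call. -/
def Placement.sub (φ : Placement B (t + 1) G) (r : Fin q) : Placement B t G where
  val := fun v => φ.val (B.embed r v)
  op := fun o => φ.op (Op.sub r o)
  inj := φ.inj.comp (B.embed_injective r)
  val_op := fun o => φ.val_op (Op.sub r o)
  fst_op := fun o => φ.fst_op (Op.sub r o)
  snd_op := fun o => φ.snd_op (Op.sub r o)

/-- The encoding operations of the outermost recursive level. -/
noncomputable def encList (B : BaseCase K m n p q) (t : ℕ) : List (B.Op (t + 1)) :=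
  (layer B.encA.size (Fin t → Fin m × Fin n)).map (fun a => Op.encA a.1 a.2) ++
    (layer B.encB.size (Fin t → Fin n × Fin p)).map (fun a => Op.encB a.1 a.2)

/-- The decoding operations of the outermost recursive level. -/
noncomputable def decList (B : BaseCase K m n p q) (t : ℕ) : List (B.Op (t + 1)) :=
  (layer B.decC.size (Fin t → Fin m × Fin p)).map fun a => Op.decC a.1 a.2

theorem length_encList : (B.encList t).length =
    B.encA.size * (m * n) ^ t + B.encB.size * (n * p) ^ t := by
  simp [encList, length_layer]

theorem length_decList : (B.decList t).length = B.decC.size * (m * p) ^ t := by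
  simp [decList, length_layer]

theorem Placement.map_naiveList (φ : Placement B (t + 1) G) :
    (B.naiveList (t + 1)).map φ.op = (B.encList t).map φ.op ++
      ((List.finRange q).map fun r => (B.naiveList t).map (φ.sub r).op).flatten ++
        (B.decList t).map φ.op := by
  simp only [naiveList, encList, decList, List.map_append, List.map_flatten, List.ofFn_eq_map,
    List.map_map, Function.comp_def]
  rfl

theorem _root_.Cdag.Ready.append {A : Set G.Val} {L L' : List G.Op} (h : G.Ready A L)
    (h' : G.Ready A L') : G.Ready A (L ++ L') := by
  induction L generalizing A with
  | nil => exact h'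
  | cons o L ih => exact ⟨h.1, h.2.1, ih h.2.2 (h'.mono (Set.subset_insert _ _))⟩

theorem Placement.ready_encList (φ : Placement B (t + 1) G) (A : Set G.Val)
    (hA : ∀ i, φ.val (Sum.inl i) ∈ A) : G.Ready A ((B.encList t).map φ.op) := by
  rw [encList, List.map_append, List.map_map, List.map_map]
  refine Cdag.Ready.append ?_ ?_
  · exact ready_layer B.encA G (fun x v => φ.val (B.vertexA x v)) (fun g x => φ.op (Op.encA g x))
      (fun x g => φ.val_op _) (fun g x => φ.fst_op _) (fun g x => φ.snd_op _) A (fun x i => hA _)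
  · exact ready_layer B.encB G (fun x v => φ.val (B.vertexB x v)) (fun g x => φ.op (Op.encB g x))
      (fun x g => φ.val_op _) (fun g x => φ.fst_op _) (fun g x => φ.snd_op _) A (fun x i => hA _)

theorem Placement.ready_decList (φ : Placement B (t + 1) G) (A : Set G.Val)
    (hA : ∀ r z, (φ.sub r).val (B.outC t z) ∈ A) : G.Ready A ((B.decList t).map φ.op) := by
  rw [decList, List.map_map]
  exact ready_layer B.decC G (fun x v => φ.val (B.vertexC x v)) (fun g x => φ.op (Op.decC g x))
    (fun x g => φ.val_op _) (fun g x => φ.fst_op _) (fun g x => φ.snd_op _) A (fun x i => hA _ _)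

/-- After the encoding, the inputs of the recursive calls are available. -/
theorem Placement.sub_inl_mem (φ : Placement B (t + 1) G) {A : Set G.Val}
    (hA : ∀ i, φ.val (Sum.inl i) ∈ A) (hE : ∀ o ∈ (B.encList t).map φ.op, Sum.inr o ∈ A)
    (r : Fin q) (i : B.Inp t) : (φ.sub r).val (Sum.inl i) ∈ A := by
  rcases i with x | y
  · change φ.val (B.vertexA x (B.encA.out r)) ∈ A
    rcases B.encA.out r with i | g
    · exact hA _
    · rw [vertexA, φ.val_op]
      refine hE _ (List.mem_map_of_mem ?_)
      exact List.mem_append_left _ (List.mem_map.2 ⟨(g, x), mem_layer _, rfl⟩)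
  · change φ.val (B.vertexB y (B.encB.out r)) ∈ A
    rcases B.encB.out r with i | g
    · exact hA _
    · rw [vertexB, φ.val_op]
      refine hE _ (List.mem_map_of_mem ?_)
      exact List.mem_append_right _ (List.mem_map.2 ⟨(g, y), mem_layer _, rfl⟩)

/-- After the decoding, the outputs are available. -/
theorem Placement.outC_mem (φ : Placement B (t + 1) G) {A : Set G.Val}
    (hA : ∀ r z, (φ.sub r).val (B.outC t z) ∈ A)
    (hD : ∀ o ∈ (B.decList t).map φ.op, Sum.inr o ∈ A) (z : Fin (t + 1) → Fin m × Fin p) :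
    φ.val (B.outC (t + 1) z) ∈ A := by
  rw [outC]
  rcases B.decC.out (z 0) with r | g
  · exact hA r _
  · simp only [φ.val_op]
    refine hD _ (List.mem_map_of_mem ?_)
    exact List.mem_map.2 ⟨(g, Fin.tail z), mem_layer _, rfl⟩

/-- Fast memory needed by the naive recursive algorithm in addition to its inputs. -/
def footprint (B : BaseCase K m n p q) : ℕ → ℕ
  | 0 => 1
  | k + 1 => B.encA.size * (m * n) ^ k + B.encB.size * (n * p) ^ k +
      (q + B.decC.size) * (m * p) ^ k + footprint B k

theorem encard_range_outC_le (φ : B.Vertex t → G.Val) :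
    (Set.range fun z => φ (B.outC t z)).encard ≤ ((m * p) ^ t : ℕ) := by
  rw [← Set.image_univ]
  refine (Set.encard_image_le _ _).trans ?_
  rw [Set.encard_univ, ENat.card_eq_coe_fintype_card]
  simp

/-- With sufficient fast memory the algorithm runs without communication, when its inputs are in
fast memory. -/
theorem Placement.exec_internal : ∀ (k : ℕ) (φ : Placement B k G) (F S : Set G.Val),
    (∀ i, φ.val (Sum.inl i) ∈ F) → (∀ o, Sum.inr (φ.op o) ∉ F) →
    F.encard + B.footprint k ≤ M →
    G.Exec M ⟨F, S⟩ ((B.naiveList k).map φ.op) 0 ⟨F ∪ Set.range fun z => φ.val (B.outC k z), S⟩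
  | 0, φ, F, S, hF, _, hM => by
    have h := Cdag.exec_compute (S := S) (L := [φ.op Op.prod])
      ⟨by rw [φ.fst_op]; exact hF _, by rw [φ.snd_op]; exact hF _, trivial⟩ hM
    have : (Set.range fun z => φ.val (B.outC 0 z)) = Sum.inr '' {o | o ∈ [φ.op Op.prod]} := by
      ext v
      simp [outC, φ.val_op]
    rwa [this]
  | k + 1, φ, F, S, hF, hFo, hM => by
    classical
    -- The results of finished calls stay in fast memory, whereas the working space is reused; this
    -- accounts for the two summands in the memory bound.
    have calls : ∀ (rs : List (Fin q)), rs.Nodup → ∀ F' : Set G.Val,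
        (∀ r i, (φ.sub r).val (Sum.inl i) ∈ F') → (∀ r ∈ rs, ∀ o, Sum.inr ((φ.sub r).op o) ∉ F') →
        F'.encard + ((rs.length * (m * p) ^ k + B.footprint k : ℕ) : ℕ∞) ≤ M →
        G.Exec M ⟨F', S⟩ (rs.map fun r => (B.naiveList k).map (φ.sub r).op).flatten 0
          ⟨F' ∪ {v | ∃ r ∈ rs, ∃ z, (φ.sub r).val (B.outC k z) = v}, S⟩ := by
      intro rs
      induction rs with
      | nil =>
        intro _ F' _ _ _
        simpa using Cdag.Exec.refl _
      | cons r rs ih =>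
        intro hnd F' hF' hF'o hM'
        rw [List.nodup_cons] at hnd
        have hfit : F'.encard + B.footprint k ≤ M := by
          refine le_trans (add_le_add_right ?_ _) hM'
          exact_mod_cast Nat.le_add_left _ _
        have h1 := exec_internal k (φ.sub r) F' S (hF' r) (hF'o r (by simp)) hfit
        have h2 := ih hnd.2 (F' ∪ Set.range fun z => (φ.sub r).val (B.outC k z))
          (fun r i => Or.inl (hF' r i)) ?_ ?_
        · have h := h1.trans h2
          rw [List.map_cons, List.flatten_cons]
          convert h using 2
          ext v
          simp only [Set.mem_union, Set.mem_range, Set.mem_ofPred_eq, List.mem_cons,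
            exists_eq_or_imp]
          tauto
        · rintro r' hr' o (h | ⟨z, h⟩)
          · exact hF'o r' (by simp [hr']) o h
          · have h' : (φ.sub r).val (B.outC k z) = φ.val (Sum.inr (Op.sub r' o)) :=
              h.trans (φ.val_op _).symm
            have h'' := φ.inj h'
            rw [outC_eq] at h''
            simp only [embed, Sum.inr.injEq, Op.sub.injEq] at h''
            exact hnd.1 (h''.1 ▸ hr')
        · refine le_trans (add_le_add_left ((Set.encard_union_le _ _).trans
            (add_le_add_right (encard_range_outC_le _) _)) _) (le_trans (le_of_eq ?_) hM')
          push_cast [List.length_cons]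
          ring
    set F₁ := F ∪ Sum.inr '' {o | o ∈ (B.encList k).map φ.op} with hF₁
    set F₂ := F₁ ∪ {v | ∃ r ∈ List.finRange q, ∃ z, (φ.sub r).val (B.outC k z) = v} with hF₂
    set F₃ := F₂ ∪ Sum.inr '' {o | o ∈ (B.decList k).map φ.op} with hF₃
    have hcF₁ : F₁.encard ≤ F.encard +
        (B.encA.size * (m * n) ^ k + B.encB.size * (n * p) ^ k : ℕ) := by
      refine (Set.encard_union_le _ _).trans (add_le_add_right ?_ _)
      refine (Cdag.encard_image_mem_list_le _).trans ?_
      rw [List.length_map, length_encList]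
    have hcF₂ : F₂.encard ≤ F₁.encard + (q * (m * p) ^ k : ℕ) := by
      refine (Set.encard_union_le _ _).trans (add_le_add_right ?_ _)
      have : {v | ∃ r ∈ List.finRange q, ∃ z, (φ.sub r).val (B.outC k z) = v} =
          (fun a : Fin q × (Fin k → Fin m × Fin p) => (φ.sub a.1).val (B.outC k a.2)) ''
            Set.univ := by
        ext v
        simp
      rw [this]
      refine (Set.encard_image_le _ _).trans ?_
      rw [Set.encard_univ, ENat.card_eq_coe_fintype_card]
      simp
    have hin₁ : ∀ r i, (φ.sub r).val (Sum.inl i) ∈ F₁ := φ.sub_inl_mem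
      (fun i => Or.inl (hF i)) (fun o ho => Or.inr ⟨o, ho, rfl⟩)
    have hout₂ : ∀ r z, (φ.sub r).val (B.outC k z) ∈ F₂ := fun r z =>
      Or.inr ⟨r, List.mem_finRange r, z, rfl⟩
    have e1 : G.Exec M ⟨F, S⟩ ((B.encList k).map φ.op) 0 ⟨F₁, S⟩ := by
      refine Cdag.exec_compute (φ.ready_encList F hF) (le_trans (add_le_add_right ?_ _) hM)
      rw [List.length_map, length_encList, footprint]
      exact_mod_cast (by omega)
    have e2 : G.Exec M ⟨F₁, S⟩ ((List.finRange q).map fun r =>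
        (B.naiveList k).map (φ.sub r).op).flatten 0 ⟨F₂, S⟩ := by
      refine calls _ (List.nodup_finRange q) F₁ hin₁ ?_ ?_
      · rintro r - o (h | ⟨o', ho', h⟩)
        · exact hFo _ h
        · obtain ⟨o'', ho'', rfl⟩ := List.mem_map.1 ho'
          rw [← φ.val_op, ← (φ.sub r).val_op] at h
          have h' : Sum.inr o'' = Sum.inr (Op.sub r o) := φ.inj h
          injection h' with h'
          subst h'
          simp [encList] at ho''
      · refine le_trans (add_le_add_left hcF₁ _) (le_trans ?_ hM)
        rw [add_assoc, List.length_finRange, footprint]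
        refine add_le_add_right ?_ _
        norm_cast
        rw [add_mul]
        omega
    have e3 : G.Exec M ⟨F₂, S⟩ ((B.decList k).map φ.op) 0 ⟨F₃, S⟩ := by
      refine Cdag.exec_compute (φ.ready_decList F₂ hout₂) ?_
      refine le_trans (add_le_add_left (hcF₂.trans (add_le_add_left hcF₁ _)) _) (le_trans ?_ hM)
      rw [List.length_map, length_decList, footprint, add_assoc, add_assoc]
      refine add_le_add_right ?_ _
      norm_cast
      rw [add_mul]
      omega
    -- All computed values except the outputs are dropped. Since `F` held no operation of this call,
    -- exactly `F` and the outputs remain.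
    have e4 := Cdag.exec_discard (M := M) F₃ S (((B.naiveList (k + 1)).map
      fun o => φ.val (Sum.inr o)).filter fun v => v ∉ Set.range fun z => φ.val (B.outC (k + 1) z))
    have h := ((e1.trans e2).trans e3).trans e4
    rw [φ.map_naiveList]
    simp only [List.append_nil, add_zero] at h
    convert h using 2
    ext v
    simp only [Set.mem_sdiff, Set.mem_ofPred_eq, List.mem_filter, List.mem_map, decide_eq_true_eq,
      not_and, not_not]
    constructor
    · rintro (hv | hv)
      · refine ⟨Or.inl (Or.inl (Or.inl hv)), ?_⟩
        rintro ⟨o, -, rfl⟩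
        rw [φ.val_op] at hv
        exact absurd hv (hFo o)
      · refine ⟨?_, fun _ => hv⟩
        obtain ⟨z, rfl⟩ := hv
        exact φ.outC_mem (fun r z => Or.inl (hout₂ r z)) (fun o ho => Or.inr ⟨o, ho, rfl⟩) z
    · rintro ⟨hv, hd⟩
      have hop : ∀ o, φ.val (Sum.inr o) = v → v ∈ F ∪ Set.range fun z => φ.val (B.outC (k + 1) z) :=
        fun o ho => Or.inr (hd ⟨o, B.mem_naiveList o, ho⟩)
      rcases hv with ((hv | ⟨_, ho, rfl⟩) | ⟨r, -, z, rfl⟩) | ⟨_, ho, rfl⟩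
      · exact Or.inl hv
      · obtain ⟨o, -, rfl⟩ := List.mem_map.1 ho
        exact hop o (φ.val_op o)
      · refine hop (Op.sub r (B.outOp k z)) ?_
        rw [outC_eq]
        rfl
      · obtain ⟨o, -, rfl⟩ := List.mem_map.1 ho
        exact hop o (φ.val_op o)

/-- Communication of the naive recursive algorithm when the calls for power `k` run in fast
memory. -/
def cost (B : BaseCase K m n p q) (k : ℕ) : ℕ → ℕ
  | 0 => (m * n) ^ k + (n * p) ^ k + (m * p) ^ k
  | d + 1 => 3 * (B.encA.size * (m * n) ^ (k + d) + B.encB.size * (n * p) ^ (k + d)) +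
      q * cost B k d + 3 * (B.decC.size * (m * p) ^ (k + d))

/-- Fast memory is empty between stages, so calls interact only through the growing slow memory. A
call of power `k` reads its inputs, runs internally and writes its outputs. -/
theorem Placement.exec_external (k : ℕ) (hM3 : 3 ≤ M)
    (hM : (m * n) ^ k + (n * p) ^ k + B.footprint k ≤ M) :
    ∀ (d : ℕ) (φ : Placement B (k + d) G) (S : Set G.Val), (∀ i, φ.val (Sum.inl i) ∈ S) →
    ∃ S', S ⊆ S' ∧ (∀ z, φ.val (B.outC (k + d) z) ∈ S') ∧
      G.Exec M ⟨∅, S⟩ ((B.naiveList (k + d)).map φ.op) (B.cost k d) ⟨∅, S'⟩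
  | 0, φ, S, hS => by
    let inputs : List G.Val :=
      (Finset.univ : Finset (B.Inp k)).toList.map fun i => φ.val (Sum.inl i)
    let outs : List G.Val := (Finset.univ : Finset (Fin k → Fin m × Fin p)).toList.map
      fun z => φ.val (B.outC k z)
    have hlen : inputs.length = (m * n) ^ k + (n * p) ^ k := by
      simp [inputs]
    have hleno : outs.length = (m * p) ^ k := by
      simp [outs]
    set F : Set G.Val := ∅ ∪ {v | v ∈ inputs} with hF
    have hFc : F.encard ≤ ((m * n) ^ k + (n * p) ^ k : ℕ) := by
      classical
      rw [← hlen, hF, Set.empty_union]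
      have : {v | v ∈ inputs} = (inputs.toFinset : Set G.Val) := by ext; simp
      rw [this, Set.encard_coe_eq_coe_finsetCard]
      exact_mod_cast inputs.toFinset_card_le
    have e1 : G.Exec M ⟨∅, S⟩ [] inputs.length ⟨F, S⟩ := by
      refine Cdag.exec_read ?_ ?_
      · intro v hv
        obtain ⟨i, -, rfl⟩ := List.mem_map.1 hv
        exact hS i
      · rw [hlen, Set.encard_empty, zero_add]
        exact_mod_cast (Nat.le_add_right _ _).trans hM
    have e2 := φ.exec_internal k F S (M := M)
      (fun i => Or.inr (List.mem_map.2 ⟨i, by simp, rfl⟩)) ?_ ?_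
    · have e3 : G.Exec M ⟨F ∪ Set.range fun z => φ.val (B.outC k z), S⟩ [] outs.length
          ⟨F ∪ Set.range fun z => φ.val (B.outC k z), S ∪ {v | v ∈ outs}⟩ := by
        refine Cdag.exec_write ?_
        intro v hv
        obtain ⟨z, -, rfl⟩ := List.mem_map.1 hv
        exact Or.inr ⟨z, rfl⟩
      have e4 := Cdag.exec_discard (M := M) (F ∪ Set.range fun z => φ.val (B.outC k z))
        (S ∪ {v | v ∈ outs}) (inputs ++ outs)
      refine ⟨S ∪ {v | v ∈ outs}, Set.subset_union_left,
        fun z => Or.inr (List.mem_map.2 ⟨z, by simp, rfl⟩), ?_⟩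
      have h := ((e1.trans e2).trans e3).trans e4
      simp only [List.append_nil, List.nil_append, add_zero, hlen, hleno] at h
      have hempty : (F ∪ Set.range fun z => φ.val (B.outC k z)) \ {v | v ∈ inputs ++ outs} = ∅ := by
        refine Set.eq_empty_of_forall_notMem ?_
        rintro v ⟨hv, hn⟩
        refine hn (List.mem_append.2 ?_)
        rcases hv with (hv | hv) | ⟨z, rfl⟩
        · exact absurd hv (Set.notMem_empty v)
        · exact Or.inl hv
        · exact Or.inr (List.mem_map.2 ⟨z, by simp, rfl⟩)
      rw [hempty] at h
      exact h
    · rintro o (h | h)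
      · exact absurd h (Set.notMem_empty _)
      · obtain ⟨i, -, h⟩ := List.mem_map.1 h
        rw [← φ.val_op] at h
        cases φ.inj h
    · refine (add_le_add_left hFc _).trans ?_
      exact_mod_cast hM
  | d + 1, φ, S, hS => by
    have calls : ∀ (rs : List (Fin q)) (S : Set G.Val),
        (∀ r i, (φ.sub r).val (Sum.inl i) ∈ S) →
        ∃ S', S ⊆ S' ∧ (∀ r ∈ rs, ∀ z, (φ.sub r).val (B.outC (k + d) z) ∈ S') ∧
          G.Exec M ⟨∅, S⟩ (rs.map fun r => (B.naiveList (k + d)).map (φ.sub r).op).flatten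
            (rs.length * B.cost k d) ⟨∅, S'⟩ := by
      intro rs
      induction rs with
      | nil => exact fun S _ => ⟨S, subset_rfl, by simp, by simpa using Cdag.Exec.refl _⟩
      | cons r rs ih =>
        intro S hS
        obtain ⟨S₁, h1, h2, h3⟩ := exec_external k hM3 hM d (φ.sub r) S (hS r)
        obtain ⟨S₂, h1', h2', h3'⟩ := ih S₁ fun r i => h1 (hS r i)
        refine ⟨S₂, h1.trans h1', ?_, ?_⟩
        · intro r' hr' z
          rcases List.mem_cons.1 hr' with rfl | hr'
          · exact h1' (h2 z)
          · exact h2' r' hr' z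
        · have h := h3.trans h3'
          rw [List.map_cons, List.flatten_cons, List.length_cons, Nat.succ_mul,
            add_comm (rs.length * _)]
          exact h
    have e1 := Cdag.exec_external (φ.ready_encList S hS) hM3
    obtain ⟨S₂, hS₂, hout₂, e2⟩ := calls (List.finRange q)
      (S ∪ Sum.inr '' {o | o ∈ (B.encList (k + d)).map φ.op})
      (φ.sub_inl_mem (fun i => Or.inl (hS i)) (fun o ho => Or.inr ⟨o, ho, rfl⟩))
    have hout : ∀ r z, (φ.sub r).val (B.outC (k + d) z) ∈ S₂ :=
      fun r z => hout₂ r (List.mem_finRange r) z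
    have e3 := Cdag.exec_external (φ.ready_decList S₂ hout) hM3
    refine ⟨S₂ ∪ Sum.inr '' {o | o ∈ (B.decList (k + d)).map φ.op},
      (Set.subset_union_left.trans hS₂).trans Set.subset_union_left,
      φ.outC_mem (fun r z => Or.inl (hout r z)) (fun o ho => Or.inr ⟨o, ho, rfl⟩), ?_⟩
    have h := (e1.trans e2).trans e3
    rw [List.length_map, List.length_map, length_encList, length_decList,
      List.length_finRange] at h
    obtain ⟨s, hrun, hord, hw⟩ := h
    exact ⟨s, hrun, hord.trans φ.map_naiveList.symm, hw⟩

theorem exists_schedule (B : BaseCase K m n p q) {M : ℕ} (k d : ℕ) (hM3 : 3 ≤ M)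
    (hM : (m * n) ^ k + (n * p) ^ k + B.footprint k ≤ M) :
    ∃ s : List (B.power (k + d)).Instr, (B.power (k + d)).IsSchedule M s ∧
      B.IsNaiveOrder (k + d) ((B.power (k + d)).order s) ∧
      (B.power (k + d)).words s ≤ B.cost k d := by
  obtain ⟨S', -, hout, s, hrun, hord, hw⟩ := Placement.exec_external k hM3 hM d
    (Placement.id B (k + d)) (Set.range Sum.inl) fun i => ⟨i, rfl⟩
  have hord' : (B.power (k + d)).order s = B.naiveList (k + d) :=
    hord.trans (List.map_id _)
  refine ⟨s, ⟨⟨_, hrun, ?_⟩, ?_, ?_⟩, ?_, hw⟩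
  · rintro _ ⟨z, rfl⟩
    exact hout z
  · rw [hord']
    exact B.nodup_naiveList _
  · rw [hord']
    exact fun o => B.mem_naiveList o
  · rw [hord']
    exact B.isNaiveOrder_naiveList _

end BaseCase

/-! ### Estimates of memory and cost -/

namespace BaseCase

variable {K : Type*} {m n p q : ℕ} (B : BaseCase K m n p q)

/-- With `n ≤ m` and `n ≤ p` every block is bounded by the result block, and the sum over the levels
is geometric with ratio `m * p ≥ 2`. -/
theorem footprint_le (hnm : n ≤ m) (hnp : n ≤ p) (hmp : 1 < m * p) (hq : m * p < q) (k : ℕ) :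
    B.footprint k ≤ (B.encA.size + B.encB.size + q + B.decC.size) * (m * p) ^ k := by
  set c := B.encA.size + B.encB.size + q + B.decC.size with hc
  induction k with
  | zero => simp only [footprint, pow_zero]; omega
  | succ k ih =>
    have h1 : (m * n) ^ k ≤ (m * p) ^ k := Nat.pow_le_pow_left (Nat.mul_le_mul le_rfl hnp) k
    have h2 : (n * p) ^ k ≤ (m * p) ^ k := Nat.pow_le_pow_left (Nat.mul_le_mul hnm le_rfl) k
    calc B.footprint (k + 1) ≤ B.encA.size * (m * p) ^ k + B.encB.size * (m * p) ^ k +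
          (q + B.decC.size) * (m * p) ^ k + c * (m * p) ^ k := by
          rw [footprint]
          gcongr
      _ = c * (m * p) ^ k * 2 := by rw [hc]; ring
      _ ≤ c * (m * p) ^ k * (m * p) := Nat.mul_le_mul le_rfl hmp
      _ = c * (m * p) ^ (k + 1) := by ring

/-- The extra summand on the left strengthens the induction: it absorbs the linear operations of a
new level because `m * p + 1 ≤ q`. -/
theorem cost_le (hnm : n ≤ m) (hnp : n ≤ p) (hq : m * p < q) (k d : ℕ) :
    B.cost k d + 3 * (B.encA.size + B.encB.size + B.decC.size) * (m * p) ^ (k + d) ≤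
      (3 + 3 * (B.encA.size + B.encB.size + B.decC.size)) * (q ^ d * (m * p) ^ k) := by
  set c := 3 * (B.encA.size + B.encB.size + B.decC.size) with hc
  have h1 : ∀ k, (m * n) ^ k ≤ (m * p) ^ k := Nat.pow_le_pow_left (Nat.mul_le_mul le_rfl hnp)
  have h2 : ∀ k, (n * p) ^ k ≤ (m * p) ^ k := Nat.pow_le_pow_left (Nat.mul_le_mul hnm le_rfl)
  induction d with
  | zero =>
    have := h1 k
    have := h2 k
    simp only [cost, add_zero, pow_zero, one_mul, add_mul 3]
    omega
  | succ d ih =>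
    calc B.cost k (d + 1) + c * (m * p) ^ (k + (d + 1))
        ≤ 3 * (B.encA.size * (m * p) ^ (k + d) + B.encB.size * (m * p) ^ (k + d)) +
          q * B.cost k d + 3 * (B.decC.size * (m * p) ^ (k + d)) +
            c * (m * p) ^ (k + (d + 1)) := by
          rw [cost]
          gcongr
      _ = q * B.cost k d + c * (m * p) ^ (k + d) * (m * p + 1) := by rw [hc]; ring
      _ ≤ q * B.cost k d + c * (m * p) ^ (k + d) * q := by gcongr; exact hq
      _ = q * (B.cost k d + c * (m * p) ^ (k + d)) := by ring
      _ ≤ q * ((3 + c) * (q ^ d * (m * p) ^ k)) := Nat.mul_le_mul le_rfl ih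
      _ = _ := by ring

end BaseCase

/-! ### The two bounds with real exponents -/

theorem pow_eq_rpow_logb {a b : ℝ} (ha : 1 < a) (hb : 0 < b) (j : ℕ) :
    b ^ j = (a ^ j) ^ Real.logb a b := by
  have h : a ^ Real.logb a b = b := Real.rpow_logb (by linarith) ha.ne' hb
  rw [← Real.rpow_natCast a j, ← Real.rpow_mul (by linarith), mul_comm, Real.rpow_mul (by linarith),
    h, Real.rpow_natCast]

theorem one_le_logb {a b : ℝ} (ha : 1 < a) (hab : a ≤ b) : 1 ≤ Real.logb a b := by
  rw [Real.le_logb_iff_rpow_le ha (by linarith), Real.rpow_one]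
  exact hab

theorem rpow_eq_mul_rpow_sub_one {x : ℝ} (hx : 0 < x) (w : ℝ) : x ^ w = x * x ^ (w - 1) := by
  rw [Real.rpow_sub_one hx.ne']
  field_simp

namespace BaseCase

variable {K : Type*} {m n p q : ℕ} (B : BaseCase K m n p q)

theorem lower_bound (hdec : B.decC.graph.Connected) (hinj : Function.Injective B.decC.out)
    (hmp : 1 < m * p) (hq : m * p < q) :
    ∃ c : ℝ, 0 < c ∧ ∀ t M : ℕ, 1 ≤ M →
      ∀ s : List (B.power t).Instr, (B.power t).IsSchedule M s →
        c * ((q : ℝ) ^ t / (M : ℝ) ^ (Real.logb ((m : ℝ) * p) q - 1)) ≤ (B.power t).words s := by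
  set a : ℝ := (m : ℝ) * p with ha
  set w := Real.logb a q with hw
  have ha1 : 1 < a := by rw [ha]; exact_mod_cast hmp
  have haq : a ≤ q := by rw [ha]; exact_mod_cast hq.le
  have hq0 : (0 : ℝ) < q := by linarith
  have hw1 : 1 ≤ w := one_le_logb ha1 haq
  -- The factor `3 * q ^ 2` comes from `mul_pow_le_words`; the factor `a` pays for rounding up to a
  -- power of `a`.
  set A : ℝ := 3 * q ^ 2 * a with hA
  have hA1 : 1 ≤ A := by
    have : 1 ≤ (q : ℝ) ^ 2 := one_le_pow₀ (by linarith)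
    rw [hA]
    nlinarith
  have hA0 : 0 < A := by linarith
  refine ⟨(A ^ w)⁻¹, inv_pos.2 (Real.rpow_pos_of_pos hA0 _), ?_⟩
  intro t M hM s hs
  have hM0 : (0 : ℝ) < M := by exact_mod_cast hM
  suffices h : (q : ℝ) ^ t ≤ A ^ w * (M : ℝ) ^ (w - 1) * (B.power t).words s by
    rw [inv_mul_le_iff₀ (Real.rpow_pos_of_pos hA0 _), div_le_iff₀ (Real.rpow_pos_of_pos hM0 _)]
    linarith
  have hex : ∃ j, 3 * q ^ 2 * M ≤ (m * p) ^ j :=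
    ⟨3 * q ^ 2 * M, (Nat.lt_pow_self hmp).le⟩
  obtain ⟨j, hj, hjA⟩ : ∃ j, 3 * q ^ 2 * M ≤ (m * p) ^ j ∧ a ^ j ≤ A * M := by
    classical
    refine ⟨Nat.find hex, Nat.find_spec hex, ?_⟩
    rcases hj : Nat.find hex with _ | j
    · have : (1 : ℝ) ≤ M := by exact_mod_cast hM
      rw [pow_zero]
      nlinarith
    · have h := Nat.find_min hex (m := j) (by omega)
      push Not at h
      have h' : a ^ j ≤ 3 * q ^ 2 * M := by
        rw [ha]
        exact_mod_cast h.le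
      rw [pow_succ, hA]
      nlinarith
  have hAw : A ^ (w - 1) ≤ A ^ w := Real.rpow_le_rpow_of_exponent_le hA1 (by linarith)
  -- For `j < t` there are calls of power `j + 1` to cut into segments; otherwise `a ^ t ≤ A * M`
  -- and the output bound suffices.
  rcases Nat.lt_or_ge j t with hjt | hjt
  · obtain ⟨d, rfl⟩ : ∃ d, t = j + 1 + d := ⟨t - (j + 1), by omega⟩
    have hW : (M : ℝ) * q ^ (d + 1) ≤ (B.power (j + 1 + d)).words s := by
      exact_mod_cast B.mul_pow_le_words hdec hinj hmp hq hj hs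
    calc (q : ℝ) ^ (j + 1 + d) = (a ^ j) ^ w * q ^ (d + 1) := by
          rw [← pow_eq_rpow_logb ha1 hq0]; ring
      _ ≤ (A * M) ^ w * q ^ (d + 1) := by gcongr
      _ = A ^ w * M ^ (w - 1) * (M * q ^ (d + 1)) := by
          rw [Real.mul_rpow hA0.le hM0.le, rpow_eq_mul_rpow_sub_one hM0]; ring
      _ ≤ _ := by gcongr
  · have hW : a ^ t ≤ (B.power t).words s := by
      rw [ha]
      exact_mod_cast B.pow_le_words hinj hs
    have hat : a ^ t ≤ A * M := (pow_le_pow_right₀ ha1.le hjt).trans hjA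
    calc (q : ℝ) ^ t = (a ^ t) ^ (w - 1) * a ^ t := by
          rw [pow_eq_rpow_logb ha1 hq0, rpow_eq_mul_rpow_sub_one (by positivity), mul_comm]
      _ ≤ (A * M) ^ (w - 1) * (B.power t).words s := by
          gcongr
      _ = A ^ (w - 1) * M ^ (w - 1) * (B.power t).words s := by
          rw [Real.mul_rpow hA0.le hM0.le]
      _ ≤ _ := by gcongr

theorem upper_bound (hnm : n ≤ m) (hnp : n ≤ p) (hmp : 1 < m * p) (hq : m * p < q) :
    ∃ C : ℝ, 0 < C ∧ ∀ t M : ℕ, 3 ≤ M → M ≤ 3 * (m * p) ^ t →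
      ∃ s : List (B.power t).Instr, (B.power t).IsSchedule M s ∧
        B.IsNaiveOrder t ((B.power t).order s) ∧
        ((B.power t).words s : ℝ) ≤
          C * ((q : ℝ) ^ t / (M : ℝ) ^ (Real.logb ((m : ℝ) * p) q - 1)) := by
  classical
  set a : ℝ := (m : ℝ) * p with ha
  set w := Real.logb a q with hw
  have ha1 : 1 < a := by rw [ha]; exact_mod_cast hmp
  have haq : a ≤ q := by rw [ha]; exact_mod_cast hq.le
  have hq0 : (0 : ℝ) < q := by linarith
  have hw1 : 1 ≤ w := one_le_logb ha1 haq
  set c₀ := 2 + (B.encA.size + B.encB.size + q + B.decC.size) with hc₀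
  set c₁ := 3 + 3 * (B.encA.size + B.encB.size + B.decC.size) with hc₁
  set D : ℝ := c₀ * a with hD
  have hD0 : 0 < D := by positivity
  refine ⟨c₁ * D ^ (w - 1), by positivity, ?_⟩
  intro t M hM3 hMt
  have hM0 : (0 : ℝ) < M := by exact_mod_cast (by omega : 0 < M)
  -- Powers whose calls fit into fast memory. Power 0 always does: two operands and a product take
  -- three words.
  let P : ℕ → Prop := fun k => k = 0 ∨ c₀ * (m * p) ^ k ≤ M
  obtain ⟨k, hkt, hPk, hkM⟩ : ∃ k ≤ t, P k ∧ (M : ℝ) ≤ D * a ^ k := by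
    refine ⟨Nat.findGreatest P t, Nat.findGreatest_le t,
      Nat.findGreatest_spec (Nat.zero_le t) (Or.inl rfl), ?_⟩
    have key : M ≤ c₀ * (m * p) ^ (Nat.findGreatest P t + 1) → (M : ℝ) ≤
        D * a ^ Nat.findGreatest P t := by
      intro h
      calc (M : ℝ) ≤ ((c₀ * (m * p) ^ (Nat.findGreatest P t + 1) : ℕ) : ℝ) := by exact_mod_cast h
        _ = D * a ^ Nat.findGreatest P t := by
          rw [hD, ha]
          push_cast
          ring
    apply key
    rcases (Nat.findGreatest_le (P := P) t).lt_or_eq with hlt | heq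
    · by_contra hcon
      push Not at hcon
      exact Nat.findGreatest_is_greatest (P := P) (Nat.lt_succ_self _) hlt (Or.inr hcon.le)
    -- If all powers up to `t` fit, maximality says nothing; here the assumption `M ≤ 3 * (m * p) ^
    -- t` is used, with `3 ≤ c₀`.
    · rw [heq]
      exact hMt.trans (Nat.mul_le_mul (by omega) (Nat.pow_le_pow_right (by omega) (by omega)))
  obtain ⟨d, rfl⟩ := Nat.exists_eq_add_of_le hkt
  have hmem : (m * n) ^ k + (n * p) ^ k + B.footprint k ≤ M := by
    rcases hPk with rfl | h
    · simpa [footprint] using hM3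
    · have h1 : (m * n) ^ k ≤ (m * p) ^ k := Nat.pow_le_pow_left (Nat.mul_le_mul le_rfl hnp) k
      have h2 : (n * p) ^ k ≤ (m * p) ^ k := Nat.pow_le_pow_left (Nat.mul_le_mul hnm le_rfl) k
      have h3 := B.footprint_le hnm hnp hmp hq k
      rw [hc₀, add_mul] at h
      omega
  obtain ⟨s, hs, hord, hwords⟩ := B.exists_schedule k d hM3 hmem
  refine ⟨s, hs, hord, ?_⟩
  have hcost : ((B.power (k + d)).words s : ℝ) ≤ c₁ * (q ^ d * a ^ k) := by
    have := hwords.trans ((Nat.le_add_right _ _).trans (B.cost_le hnm hnp hq k d))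
    rw [ha]
    exact_mod_cast this
  rw [← mul_div_assoc, le_div_iff₀ (Real.rpow_pos_of_pos hM0 _)]
  have hak : 0 < a ^ k := by positivity
  calc ((B.power (k + d)).words s : ℝ) * M ^ (w - 1)
      ≤ c₁ * (q ^ d * a ^ k) * (D * a ^ k) ^ (w - 1) := by
        gcongr
    _ = c₁ * D ^ (w - 1) * (q ^ d * (a ^ k * (a ^ k) ^ (w - 1))) := by
        rw [Real.mul_rpow hD0.le hak.le]; ring
    _ = c₁ * D ^ (w - 1) * q ^ (k + d) := by
        rw [← rpow_eq_mul_rpow_sub_one hak, ← pow_eq_rpow_logb ha1 hq0]; ring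

end BaseCase

theorem theorem1 {K : Type*} [Field K] {m n p q : ℕ} (B : BaseCase K m n p q)
    (hB : B.IsExact ∨ ∃ v : Valuation K ℤᵐ⁰, B.IsApproximate v)
    (hn : 1 < n) (hmp : 1 < m * p) (hdec : B.decC.graph.Connected) :
    (∃ c : ℝ, 0 < c ∧ ∀ t M : ℕ, 1 ≤ M →
      ∀ s : List (B.power t).Instr, (B.power t).IsSchedule M s →
        c * ((q : ℝ) ^ t / (M : ℝ) ^ (Real.logb ((m : ℝ) * p) q - 1)) ≤ (B.power t).words s) ∧
    (n ≤ m → n ≤ p →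
      ∃ C : ℝ, 0 < C ∧ ∀ t M : ℕ, 3 ≤ M → M ≤ 3 * (m * p) ^ t →
        ∃ s : List (B.power t).Instr, (B.power t).IsSchedule M s ∧
          B.IsNaiveOrder t ((B.power t).order s) ∧
          ((B.power t).words s : ℝ) ≤
            C * ((q : ℝ) ^ t / (M : ℝ) ^ (Real.logb ((m : ℝ) * p) q - 1))) := by
  obtain ⟨v, hv⟩ := B.exists_isApproximate hB
  have hq := B.mul_lt_of_isApproximate v hv hn (by omega)
  exact ⟨B.lower_bound hdec (B.decC_out_injective v hv (by omega)) hmp hq,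
    fun hnm hnp => B.upper_bound hnm hnp hmp hq⟩
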